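/- Let $\mathbb K$ be an algebraically closed field of characteristic zero, let $k\ge 1$, $m\ge 0$, $n>1$ be integers, let $a_1,\dots,a_m>1$ and $l_1,\dots,l_n>1$ be integers, and let $$B=\mathbb K[x_1,\dots,x_k,y_1,\dots,y_m,z_1,\dots,z_n]\big/\bigl(x_1\cdots x_k\,y_1^{a_1}\cdots y_m^{a_m}-z_1^{l_1}\cdots z_n^{l_n}-1\bigr)$$ be the algebra of regular functions on the hypersurface $x_1\cdots x_k y_1^{a_1}\cdots y_m^{a_m}=z_1^{l_1}\cdots z_n^{l_n}+1$. Equip $B$ with the finest grading for which all variables are homogeneous, that is, the grading by $G=\mathbb Z^{k+m+n}/\langle(\mathbf 1,a,0),(0,0,l)\rangle$ in which the degree of a variable is the class of the corresponding standard basis vector. A derivation of $B$ is homogeneous if it sends homogeneous elements to homogeneous elements. An LND is a $\mathbb K$-linear locally nilpotent derivation $\delta$ of $B$; it is irreducible if $\delta(B)$ is not contained in any proper principal ideal of $B$; it is maximal if every nonzero LND of $B$ commuting with $\delta$ has the same kernel as $\delta$. For $1\le i\le k$, $1\le j\le n$ let $\partial_{ij}$ be the derivation of $B$ with $$\partial_{ij}(x_i)=l_jz_j^{l_j-1}\prod_{s\ne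 j}z_s^{l_s},\qquad \partial_{ij}(z_j)=y_1^{a_1}\cdots y_m^{a_m}\prod_{s\neq i}x_s,$$ and with value $0$ on all the other variables. Then every $\partial_{ij}$ is an irreducible homogeneous LND, and no irreducible homogeneous LND of $B$ is maximal. The maximal homogeneous LNDs of $B$ are exactly the derivations $h\partial_{ij}$ with $1\le i\le k$, $1\le j\le n$, where $h$ is a homogeneous polynomial that does not involve $x_i$ and $z_j$ and involves every $z_s$ with $s\ne j$. -/

import Mathlib

namespace TrinomialLND

noncomputable section

/-! ### Locally nilpotent derivations of an algebra -/

section General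

variable {K B : Type*} [Field K] [CommRing B] [Algebra K B]

/-- A derivation `δ` is locally nilpotent (an LND) if every element is killed by a power of `δ`. -/
def IsLND (δ : Derivation K B B) : Prop :=
  ∀ b : B, ∃ N : ℕ, (⇑δ)^[N] b = 0

/-- `δ` is irreducible if `δ(B)` is not contained in any proper principal ideal. -/
def IsIrreducibleDer (δ : Derivation K B B) : Prop :=
  ∀ I : Ideal B, I.IsPrincipal → I ≠ ⊤ → ¬ Set.range δ ⊆ (I : Set B)

/-- Two derivations are equivalent if their kernels coincide. -/
def Equivalent (δ D : Derivation K B B) : Prop :=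
  ∀ b : B, δ b = 0 ↔ D b = 0

/-- An LND `δ` is maximal if every nonzero LND that commutes with `δ` is equivalent to `δ`
(the zero derivation commutes with everything and corresponds to no `𝔾ₐ`-subgroup). -/
def IsMaximalDer (δ : Derivation K B B) : Prop :=
  ∀ D : Derivation K B B, IsLND D → D ≠ 0 → ⁅δ, D⁆ = 0 → Equivalent D δ

end General

/-! ### The hypersurface `x₁⋯x_k y₁^{a₁}⋯y_m^{a_m} = z₁^{l₁}⋯z_n^{l_n} + 1` -/

/-- Names of the variables: `x_i` (`i : Fin k`), `y_s` (`s : Fin m`), `z_j` (`j : Fin n`). -/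
abbrev Var (k m n : ℕ) : Type := Fin k ⊕ Fin m ⊕ Fin n

section Hypersurface

/-- The name of the variable `x_i`. -/
def vx {k m n : ℕ} (i : Fin k) : Var k m n := Sum.inl i

/-- The name of the variable `y_s`. -/
def vy {k m n : ℕ} (s : Fin m) : Var k m n := Sum.inr (Sum.inl s)

/-- The name of the variable `z_j`. -/
def vz {k m n : ℕ} (j : Fin n) : Var k m n := Sum.inr (Sum.inr j)

variable (K : Type*) [Field K] (k : ℕ) {m n : ℕ} (a : Fin m → ℕ) (l : Fin n → ℕ)

/-- The defining polynomial `x₁⋯x_k y^a - (z^l + 1)`. -/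
def defPoly : MvPolynomial (Var k m n) K :=
  (∏ i : Fin k, MvPolynomial.X (vx i)) * (∏ s : Fin m, MvPolynomial.X (vy s) ^ a s)
    - ((∏ j : Fin n, MvPolynomial.X (vz j) ^ l j) + 1)

/-- The algebra of regular functions on the hypersurface. -/
abbrev CoordRing : Type _ :=
  MvPolynomial (Var k m n) K ⧸ Ideal.span {defPoly K k a l}

/-- The projection from the polynomial ring onto the algebra of regular functions. -/
abbrev toCoord : MvPolynomial (Var k m n) K →ₐ[K] CoordRing K k a l :=
  Ideal.Quotient.mkₐ K (Ideal.span {defPoly K k a l})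

/-! ### The finest grading for which all variables are homogeneous -/

/-- The exponent vector of the monomial `x₁⋯x_k y^a`. -/
def expLeft : Var k m n → ℤ :=
  Sum.elim (fun _ => 1) (Sum.elim (fun s => (a s : ℤ)) (fun _ => 0))

variable (m) in
/-- The exponent vector of the monomial `z^l`. -/
def expRight : Var k m n → ℤ :=
  Sum.elim (fun _ => 0) (Sum.elim (fun _ => 0) (fun j => (l j : ℤ)))

/-- The grading group: the quotient of `ℤ^{k+m+n}` by the subgroup generated by the exponent
vectors of the two monomials (both monomials must have the degree `0` of the constant `1`). -/
abbrev GradingGroup : Type :=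
  (Var k m n → ℤ) ⧸ Submodule.span ℤ {expLeft k a (n := n), expRight k m l}

/-- The degree of a variable: the class of the corresponding basis vector. -/
def degVar (v : Var k m n) : GradingGroup k a l :=
  Submodule.Quotient.mk (Pi.single v 1)

variable {K k a l}

/-- Homogeneous polynomials, of some degree in the grading group. -/
def IsHomogPoly (a : Fin m → ℕ) (l : Fin n → ℕ) (p : MvPolynomial (Var k m n) K) : Prop :=
  ∃ g : GradingGroup k a l, MvPolynomial.IsWeightedHomogeneous (degVar k a l) p g

/-- Homogeneous regular functions: classes of homogeneous polynomials. -/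
def IsHomogElem (b : CoordRing K k a l) : Prop :=
  ∃ p : MvPolynomial (Var k m n) K, IsHomogPoly a l p ∧ toCoord K k a l p = b

/-- A derivation is homogeneous if it sends homogeneous elements to homogeneous elements. -/
def IsHomogDer (δ : Derivation K (CoordRing K k a l) (CoordRing K k a l)) : Prop :=
  ∀ b : CoordRing K k a l, IsHomogElem b → IsHomogElem (δ b)

/-! ### The derivations `∂_{ij}` -/

variable (K k a l)

open MvPolynomial in
/-- The derivation of the polynomial ring with
`x_i ↦ l_j z_j^{l_j - 1} ∏_{s ≠ j} z_s^{l_s}`, `z_j ↦ y^a ∏_{s ≠ i} x_s`,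
and all other variables going to `0`. -/
def polyDer (i : Fin k) (j : Fin n) :
    Derivation K (MvPolynomial (Var k m n) K) (MvPolynomial (Var k m n) K) :=
  mkDerivation K (Sum.elim
    (fun r => if r = i then
      (l j : MvPolynomial (Var k m n) K) * X (vz j) ^ (l j - 1)
        * ∏ s ∈ Finset.univ.erase j, X (vz s) ^ l s else 0)
    (Sum.elim (fun _ => 0)
      (fun p => if p = j then
        (∏ s : Fin m, X (vy s) ^ a s) * ∏ s ∈ Finset.univ.erase i, X (vx s) else 0)))

open MvPolynomial in
theorem polyDer_defPoly (i : Fin k) (j : Fin n) : polyDer K k a l i j (defPoly K k a l) = 0 := by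
  set D := polyDer K k a l i j with hD
  have prod_zero : ∀ {ι : Type} (t : Finset ι) (f : ι → MvPolynomial (Var k m n) K),
      (∀ s ∈ t, D (f s) = 0) → D (∏ s ∈ t, f s) = 0 := by
    intro ι t f hf
    refine Finset.prod_induction f (fun p => D p = 0) ?_ D.map_one_eq_zero hf
    intro p q hp hq
    rw [D.leibniz, hp, hq, smul_zero, smul_zero, add_zero]
  have hxi : D (X (vx i)) = (l j : MvPolynomial (Var k m n) K) * X (vz j) ^ (l j - 1)
        * ∏ s ∈ Finset.univ.erase j, X (vz s) ^ l s := by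
    simp [hD, polyDer, mkDerivation_X, vx]
  have hzj : D (X (vz j)) =
      (∏ s : Fin m, X (vy s) ^ a s) * ∏ s ∈ Finset.univ.erase i, X (vx s) := by
    simp [hD, polyDer, mkDerivation_X, vz]
  have hx : D (∏ s ∈ Finset.univ.erase i, X (vx s)) = 0 := by
    refine prod_zero _ _ fun s hs => ?_
    simp [hD, polyDer, mkDerivation_X, vx, Finset.ne_of_mem_erase hs]
  have hy : D (∏ s : Fin m, X (vy s) ^ a s) = 0 := by
    refine prod_zero _ _ fun s _ => ?_
    simp [hD, polyDer, mkDerivation_X, vy, Derivation.leibniz_pow]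
  have hz : D (∏ s ∈ Finset.univ.erase j, X (vz s) ^ l s) = 0 := by
    refine prod_zero _ _ fun s hs => ?_
    simp [hD, polyDer, mkDerivation_X, vz, Derivation.leibniz_pow, Finset.ne_of_mem_erase hs]
  rw [defPoly, ← Finset.mul_prod_erase Finset.univ _ (Finset.mem_univ i),
    ← Finset.mul_prod_erase Finset.univ (fun j => X (vz j) ^ l j) (Finset.mem_univ j)]
  simp only [map_sub, map_add, Derivation.leibniz, Derivation.leibniz_pow, hx, hy, hz, hxi, hzj,
    Derivation.map_one_eq_zero, smul_eq_mul, nsmul_eq_mul]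
  ring

theorem polyDer_mem (i : Fin k) (j : Fin n) (p : MvPolynomial (Var k m n) K)
    (hp : toCoord K k a l p = 0) : toCoord K k a l (polyDer K k a l i j p) = 0 := by
  have h := Ideal.Quotient.eq_zero_iff_mem.mp hp
  obtain ⟨q, rfl⟩ := Ideal.mem_span_singleton'.mp h
  have h0 : toCoord K k a l (defPoly K k a l) = 0 :=
    Ideal.Quotient.eq_zero_iff_mem.mpr (Ideal.mem_span_singleton_self _)
  rw [Derivation.leibniz, polyDer_defPoly, smul_zero, zero_add, smul_eq_mul, map_mul, h0, zero_mul]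

/-- The derivation `∂_{ij}` of the algebra of regular functions. -/
def partialDer (i : Fin k) (j : Fin n) : Derivation K (CoordRing K k a l) (CoordRing K k a l) :=
  Derivation.liftOfSurjective (f := toCoord K k a l)
    (Ideal.Quotient.mkₐ_surjective K _) (d := polyDer K k a l i j) (polyDer_mem K k a l i j)

theorem partialDer_toCoord (i : Fin k) (j : Fin n) (p : MvPolynomial (Var k m n) K) :
    partialDer K k a l i j (toCoord K k a l p) = toCoord K k a l (polyDer K k a l i j p) :=
  Derivation.liftOfSurjective_apply _ (polyDer_mem K k a l i j) p

end Hypersurface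

end

end TrinomialLND

/-! Write T for z^l, so that x₁⋯x_k y^a = T + 1, and let δ be a nonzero homogeneous LND. Kernels of
LNDs are factorially closed. If δ killed T, it would kill both monomials and hence all variables, so
δ(T) ≠ 0 (`apply_natRight_ne_zero`). A nonzero homogeneous element is a monomial times a polynomial
in T (`exists_coordMono_mul_aeval`). If it lies in the kernel, a root r of the polynomial would put
T - r in the kernel, so the polynomial is constant. The kernel is therefore generated by the
variables in it (`eq_smul_coordMono_of_apply_eq_zero`, `mem_of_apply_eq_zero`).

The last nonzero iterate of δ on a variable is thus a monomial in kernel variables. Comparing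
degrees for two variables outside the kernel shows that they cannot belong to the same monomial of
the equation (`exists_relation_of_apply_ne_zero`), so exactly one variable on each side is moved. A
degree count in the style of Mason–Stothers excludes y_s, since a_s ≥ 2 and l_j ≥ 2
(`IsLND.apply_eq_zero_or_of_pow_relation`). Hence x_i and z_j are moved, and the relation x_i
∂_{ij}(z_j) - l_j⁻¹ z_j ∂_{ij}(x_i) = 1 gives δ = h ∂_{ij} with h a kernel monomial.

If h lacks some z_s with s ≠ j, then ∂_{is} commutes with h ∂_{ij} and has another kernel, so h
∂_{ij} is not maximal. Conversely, let h contain all these z_s and let D be a nonzero LND commuting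
with h ∂_{ij}. Then h divides D(h), so D(h) = 0 and D commutes with ∂_{ij}. Rescaling z_j by a root
of unity yields D(w) = 0 for w = y^a ∏_{s≠i} x_s (`apply_cofactorX_eq_zero_of_commute`). Factorial
closedness makes D kill every variable except x_i and z_j, so D is a multiple of ∂_{ij} and has the
same kernel. Such an h is divisible by the nonunit z_s, so no maximal derivation is irreducible. -/

namespace TrinomialLND

/-! ### Degree functions and kernels of locally nilpotent derivations -/

section LND

variable {K B : Type*} [Field K] [CommRing B] [Algebra K B]

/-- `b` has degree `N` with respect to `δ`: the power `δ ^ N` is the last one not killing `b`. -/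
def HasDeg (δ : Derivation K B B) (b : B) (N : ℕ) : Prop :=
  δ^[N] b ≠ 0 ∧ δ^[N + 1] b = 0

theorem iterate_zero_of_le {δ : Derivation K B B} {b : B} {N M : ℕ} (h : δ^[N] b = 0)
    (hNM : N ≤ M) : δ^[M] b = 0 := by
  obtain ⟨r, rfl⟩ := Nat.exists_eq_add_of_le hNM
  rw [add_comm, Function.iterate_add_apply, h, iterate_map_zero]

theorem HasDeg.unique {δ : Derivation K B B} {b : B} {N M : ℕ} (h : HasDeg δ b N)
    (h' : HasDeg δ b M) : N = M := by
  by_contra hne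
  rcases Nat.lt_or_gt_of_ne hne with hlt | hlt
  · exact h'.1 (iterate_zero_of_le h.2 hlt)
  · exact h.1 (iterate_zero_of_le h'.2 hlt)

theorem IsLND.exists_hasDeg {δ : Derivation K B B} (hδ : IsLND δ) {b : B} (hb : b ≠ 0) :
    ∃ N, HasDeg δ b N := by
  classical
  have hex := hδ b
  have hpos : Nat.find hex ≠ 0 := by
    intro h0
    have := Nat.find_spec hex
    rw [h0] at this
    exact hb this
  obtain ⟨N, hN⟩ := Nat.exists_eq_succ_of_ne_zero hpos
  refine ⟨N, fun h => ?_, ?_⟩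
  · exact Nat.find_min hex (m := N) (by omega) h
  · have := Nat.find_spec hex
    rwa [hN] at this

theorem hasDeg_zero_iff {δ : Derivation K B B} {b : B} : HasDeg δ b 0 ↔ b ≠ 0 ∧ δ b = 0 :=
  Iff.rfl

theorem hasDeg_succ_iff {δ : Derivation K B B} {b : B} {N : ℕ} :
    HasDeg δ b (N + 1) ↔ HasDeg δ (δ b) N :=
  Iff.rfl

theorem HasDeg.ne_zero {δ : Derivation K B B} {b : B} {N : ℕ} (h : HasDeg δ b N) : b ≠ 0 := by
  rintro rfl
  exact h.1 (iterate_map_zero δ N)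

theorem iterate_mul_of_apply_eq_zero {δ : Derivation K B B} {b : B} (hb : δ b = 0) (c : B) (N : ℕ) :
    δ^[N] (b * c) = b * δ^[N] c := by
  induction N generalizing c with
  | zero => rfl
  | succ N ih =>
    rw [Function.iterate_succ_apply, Function.iterate_succ_apply, Derivation.leibniz, hb, smul_zero,
      add_zero, smul_eq_mul, ih]

/-- The top term of the Leibniz rule for iterates. -/
theorem iterate_mul_top {δ : Derivation K B B} (N M : ℕ) (b c : B) (hb : δ^[N + 1] b = 0)
    (hc : δ^[M + 1] c = 0) :
    δ^[N + M] (b * c) = (N + M).choose N * (δ^[N] b * δ^[M] c) := by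
  induction N generalizing M b c with
  | zero => simpa using iterate_mul_of_apply_eq_zero hb c M
  | succ N ihN =>
    induction M generalizing b c with
    | zero =>
      have := iterate_mul_of_apply_eq_zero (δ := δ) (b := c) hc b (N + 1)
      rw [mul_comm b c, add_zero, this, Nat.choose_self]
      simp [mul_comm]
    | succ M ihM =>
      have h1 := ihM b (δ c) hb hc
      have h2 := ihN (M + 1) (δ b) c hb hc
      rw [show N + (M + 1) = N + 1 + M by ring] at h2
      rw [show N + 1 + (M + 1) = (N + 1 + M) + 1 by ring, Function.iterate_succ_apply,
        Derivation.leibniz, iterate_map_add, smul_eq_mul, smul_eq_mul, mul_comm c, h1, h2,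
        Nat.choose_succ_succ' (N + 1 + M) N]
      rw [← Function.iterate_succ_apply, ← Function.iterate_succ_apply]
      push_cast
      ring

theorem iterate_mul_eq_zero {δ : Derivation K B B} (N M : ℕ) (b c : B) (hb : δ^[N + 1] b = 0)
    (hc : δ^[M + 1] c = 0) : δ^[N + M + 1] (b * c) = 0 := by
  rw [Function.iterate_succ_apply', iterate_mul_top N M b c hb hc]
  have h1 : δ (δ^[N] b) = 0 := by rwa [Function.iterate_succ_apply'] at hb
  have h2 : δ (δ^[M] c) = 0 := by rwa [Function.iterate_succ_apply'] at hc
  simp [Derivation.leibniz, h1, h2]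

variable (δ : Derivation K B B) in
/-- The elements killed by some power of `δ`. -/
def nilSubalgebra : Subalgebra K B where
  carrier := {b | ∃ N : ℕ, δ^[N] b = 0}
  mul_mem' := by
    rintro b c ⟨N, hN⟩ ⟨M, hM⟩
    exact ⟨N + M + 1, iterate_mul_eq_zero N M b c (iterate_zero_of_le hN (by omega))
      (iterate_zero_of_le hM (by omega))⟩
  add_mem' := by
    rintro b c ⟨N, hN⟩ ⟨M, hM⟩
    refine ⟨N + M, ?_⟩
    rw [iterate_map_add, iterate_zero_of_le hN (by omega), iterate_zero_of_le hM (by omega),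
      add_zero]
  algebraMap_mem' r := ⟨1, by simp⟩

variable (δ : Derivation K B B) in
/-- The kernel of a derivation. -/
def kerSubalgebra : Subalgebra K B where
  carrier := {b | δ b = 0}
  mul_mem' := by
    intro b c hb hc
    simp only [Set.mem_ofPred_eq] at hb hc ⊢
    simp [Derivation.leibniz, hb, hc]
  add_mem' := by
    intro b c hb hc
    simp only [Set.mem_ofPred_eq] at hb hc ⊢
    simp [hb, hc]
  algebraMap_mem' r := by simp

theorem mem_kerSubalgebra {δ : Derivation K B B} {b : B} : b ∈ kerSubalgebra δ ↔ δ b = 0 := Iff.rfl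

theorem mem_nilSubalgebra_of_apply_mem {δ : Derivation K B B} {b : B}
    (h : δ b ∈ nilSubalgebra δ) : b ∈ nilSubalgebra δ := by
  obtain ⟨N, hN⟩ := h
  exact ⟨N + 1, hN⟩

theorem IsLND.smul {δ : Derivation K B B} (hδ : IsLND δ) {h : B} (hh : δ h = 0) :
    IsLND (h • δ) := by
  intro b
  obtain ⟨N, hN⟩ := hδ b
  refine ⟨N, ?_⟩
  have key : ∀ M, (h • δ)^[M] b = h ^ M * δ^[M] b := by
    intro M
    induction M with
    | zero => simp
    | succ M ih =>
      rw [Function.iterate_succ_apply', Function.iterate_succ_apply', ih, Derivation.smul_apply,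
        Derivation.leibniz, Derivation.leibniz_pow, hh]
      simp [pow_succ]
      ring
  rw [key, hN, mul_zero]

theorem zero_smul_derivation (δ : Derivation K B B) : (0 : B) • δ = 0 :=
  Derivation.ext fun _ => zero_mul _

theorem algebraMap_inv_mul_natCast [CharZero K] {r : ℕ} (hr : r ≠ 0) :
    algebraMap K B (r : K)⁻¹ * (r : B) = 1 := by
  rw [← map_natCast (algebraMap K B), ← map_mul, inv_mul_cancel₀ (by exact_mod_cast hr), map_one]

variable [CharZero K] [IsDomain B]

/-- The leading Leibniz term survives because the binomial coefficient is nonzero in characteristic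
zero and `B` is a domain. Factorial closedness of the kernel rests on this additivity. -/
theorem HasDeg.mul {δ : Derivation K B B} {b c : B} {N M : ℕ} (hb : HasDeg δ b N)
    (hc : HasDeg δ c M) : HasDeg δ (b * c) (N + M) := by
  refine ⟨?_, iterate_mul_eq_zero N M b c hb.2 hc.2⟩
  have : CharZero B := charZero_of_injective_algebraMap (algebraMap K B).injective
  rw [iterate_mul_top N M b c hb.2 hc.2]
  refine mul_ne_zero ?_ (mul_ne_zero hb.1 hc.1)
  exact_mod_cast (Nat.choose_pos (Nat.le_add_right N M)).ne'

theorem HasDeg.pow {δ : Derivation K B B} {b : B} {N : ℕ} (hb : HasDeg δ b N) (r : ℕ) :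
    HasDeg δ (b ^ r) (r * N) := by
  induction r with
  | zero => simpa using hasDeg_zero_iff.2 ⟨one_ne_zero, δ.map_one_eq_zero⟩
  | succ r ih => rw [pow_succ, Nat.succ_mul]; exact ih.mul hb

theorem HasDeg.le_of_dvd {δ : Derivation K B B} (hδ : IsLND δ) {b c : B} {N M : ℕ}
    (hb : HasDeg δ b N) (hc : HasDeg δ c M) (h : b ∣ c) : N ≤ M := by
  obtain ⟨d, rfl⟩ := h
  obtain ⟨R, hR⟩ := hδ.exists_hasDeg (right_ne_zero_of_mul hc.ne_zero)
  have := (hb.mul hR).unique hc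
  omega

/-- The kernel of a locally nilpotent derivation is factorially closed. -/
theorem IsLND.apply_eq_zero_of_dvd {δ : Derivation K B B} (hδ : IsLND δ) {b c : B} (hc : c ≠ 0)
    (hc' : δ c = 0) (h : b ∣ c) : δ b = 0 := by
  have hb : b ≠ 0 := by
    rintro rfl
    exact hc (zero_dvd_iff.1 h)
  obtain ⟨N, hN⟩ := hδ.exists_hasDeg hb
  have := hN.le_of_dvd hδ (hasDeg_zero_iff.2 ⟨hc, hc'⟩) h
  obtain rfl : N = 0 := by omega
  exact hN.2

/-- Outside the kernel δ lowers the degree by one, whereas a nonzero multiple of `b` has at least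
the degree of `b`. -/
theorem IsLND.apply_eq_zero_of_dvd_apply {δ : Derivation K B B} (hδ : IsLND δ) {b : B}
    (h : b ∣ δ b) : δ b = 0 := by
  by_contra hne
  have hb : b ≠ 0 := by
    rintro rfl
    exact hne (map_zero δ)
  obtain ⟨N, hN⟩ := hδ.exists_hasDeg hb
  obtain ⟨M, hM⟩ := hδ.exists_hasDeg hne
  have h1 := hN.unique (hasDeg_succ_iff.2 hM)
  have h2 := hN.le_of_dvd hδ hM h
  omega

/-- A multiple of a nonzero locally nilpotent derivation is locally nilpotent only if the factor
lies in the kernel. -/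
theorem IsLND.apply_eq_zero_of_smul {δ : Derivation K B B} (hδ : IsLND δ) {h : B}
    (hh : IsLND (h • δ)) : δ h = 0 := by
  by_contra hne
  have hh0 : h ≠ 0 := by
    rintro rfl
    exact hne (map_zero δ)
  obtain ⟨d, hd⟩ := hδ.exists_hasDeg hh0
  have hd0 : d ≠ 0 := by
    rintro rfl
    exact hne hd.2
  -- If δ(h) ≠ 0, then h has degree d ≥ 1 and each application of hδ changes the degree by d - 1 ≥
  -- 0, so the iterates on h never vanish.
  have step : ∀ N : ℕ, ∃ M, M ≠ 0 ∧ HasDeg δ ((h • δ)^[N] h) M := by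
    intro N
    induction N with
    | zero => exact ⟨d, hd0, hd⟩
    | succ N ih =>
      obtain ⟨M, hM0, hM⟩ := ih
      obtain ⟨M, rfl⟩ := Nat.exists_eq_succ_of_ne_zero hM0
      rw [Function.iterate_succ_apply']
      exact ⟨d + M, by omega, hd.mul (hasDeg_succ_iff.1 hM)⟩
  obtain ⟨N, hN⟩ := hh h
  obtain ⟨M, -, hM⟩ := step N
  exact hM.ne_zero hN

end LND

/-! ### Monomials, points and integrality of the coordinate ring -/

section Coordinates

open MvPolynomial

variable (K : Type*) [Field K] (k : ℕ) {m n : ℕ} (a : Fin m → ℕ) (l : Fin n → ℕ)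

/-- The class of a variable. -/
noncomputable abbrev coordVar (v : Var k m n) : CoordRing K k a l := toCoord K k a l (X v)

/-- The class of a monomial. -/
noncomputable def coordMono (ν : Var k m n →₀ ℕ) : CoordRing K k a l :=
  toCoord K k a l (monomial ν 1)

/-- The exponent vector of `x₁⋯x_k y^a`. -/
noncomputable def natLeft (n : ℕ) : Var k m n →₀ ℕ :=
  Finsupp.equivFunOnFinite.symm (Sum.elim (fun _ => 1) (Sum.elim a (fun _ => 0)))

/-- The exponent vector of `z^l`. -/
noncomputable def natRight (m : ℕ) : Var k m n →₀ ℕ :=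
  Finsupp.equivFunOnFinite.symm (Sum.elim (fun _ => 0) (Sum.elim (fun _ => 0) l))

@[simp] theorem natLeft_vx (i : Fin k) : natLeft k a n (vx i) = 1 := rfl
@[simp] theorem natLeft_vy (s : Fin m) : natLeft k a n (vy s) = a s := rfl
@[simp] theorem natLeft_vz (j : Fin n) : natLeft k a n (vz j) = 0 := rfl
@[simp] theorem natRight_vx (i : Fin k) : natRight k l m (vx i) = 0 := rfl
@[simp] theorem natRight_vy (s : Fin m) : natRight k l m (vy s) = 0 := rfl
@[simp] theorem natRight_vz (j : Fin n) : natRight k l m (vz j) = l j := rfl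

theorem coordMono_zero : coordMono K k a l 0 = 1 := by
  simp only [coordMono, monomial_zero', map_one]

theorem coordMono_add (μ ν : Var k m n →₀ ℕ) :
    coordMono K k a l (μ + ν) = coordMono K k a l μ * coordMono K k a l ν := by
  rw [coordMono, coordMono, coordMono, ← map_mul, monomial_mul, one_mul]

theorem coordMono_nsmul (r : ℕ) (ν : Var k m n →₀ ℕ) :
    coordMono K k a l (r • ν) = coordMono K k a l ν ^ r := by
  rw [coordMono, coordMono, ← map_pow, monomial_pow, one_pow]

theorem coordMono_single (v : Var k m n) (r : ℕ) :
    coordMono K k a l (Finsupp.single v r) = coordVar K k a l v ^ r := by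
  rw [coordMono, ← map_pow, X_pow_eq_monomial]

theorem coordMono_eq_prod (ν : Var k m n →₀ ℕ) :
    coordMono K k a l ν = ∏ v, coordVar K k a l v ^ ν v := by
  rw [coordMono, monomial_eq, C_1, one_mul, Finsupp.prod_fintype _ _ (fun _ => pow_zero _),
    map_prod]
  simp only [map_pow]

theorem coordMono_eq_mul_erase (ν : Var k m n →₀ ℕ) (v : Var k m n) :
    coordMono K k a l ν = coordMono K k a l (ν.erase v) * coordVar K k a l v ^ ν v := by
  conv_lhs => rw [← Finsupp.erase_add_single v ν]
  rw [coordMono_add, coordMono_single]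

theorem coordVar_dvd_coordMono {ν : Var k m n →₀ ℕ} {v : Var k m n} (h : ν v ≠ 0) :
    coordVar K k a l v ∣ coordMono K k a l ν := by
  rw [coordMono_eq_mul_erase K k a l ν v]
  exact (dvd_pow_self _ h).mul_left _

theorem toCoord_monomial (ν : Var k m n →₀ ℕ) (c : K) :
    toCoord K k a l (monomial ν c) = algebraMap K _ c * coordMono K k a l ν := by
  rw [coordMono, ← Algebra.smul_def, ← map_smul, smul_monomial, smul_eq_mul, mul_one]

theorem prod_pow_sum {M : Type*} [CommMonoid M] (f : Var k m n → M) (e : Var k m n → ℕ) :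
    ∏ v, f v ^ e v = (∏ i, f (vx i) ^ e (vx i)) * ((∏ s, f (vy s) ^ e (vy s)) *
      ∏ j, f (vz j) ^ e (vz j)) := by
  rw [Fintype.prod_sum_type, Fintype.prod_sum_type]
  rfl

/-- The defining relation of the hypersurface. -/
theorem coordMono_natLeft :
    coordMono K k a l (natLeft k a n) = coordMono K k a l (natRight k l m) + 1 := by
  have h : toCoord K k a l ((∏ i : Fin k, X (vx i)) * (∏ s : Fin m, X (vy s) ^ a s)
      - ((∏ j : Fin n, X (vz j) ^ l j) + 1)) = 0 :=
    Ideal.Quotient.eq_zero_iff_mem.mpr (Ideal.mem_span_singleton_self _)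
  rw [coordMono_eq_prod, coordMono_eq_prod, prod_pow_sum, prod_pow_sum]
  simp only [map_sub, map_mul, map_prod, map_pow, map_add, map_one, sub_eq_zero] at h
  simpa only [natLeft_vx, natLeft_vy, natLeft_vz, natRight_vx, natRight_vy, natRight_vz, pow_one,
    pow_zero, Finset.prod_const_one, mul_one, one_mul] using h

theorem eq_top_of_coordVar_mem {S : Subalgebra K (CoordRing K k a l)}
    (h : ∀ v, coordVar K k a l v ∈ S) (b : CoordRing K k a l) : b ∈ S := by
  obtain ⟨p, rfl⟩ := Ideal.Quotient.mkₐ_surjective K _ b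
  induction p using MvPolynomial.induction_on with
  | C r =>
    have : toCoord K k a l (C r) = algebraMap K _ r := (toCoord K k a l).commutes r
    exact this ▸ S.algebraMap_mem r
  | add p q hp hq => rw [map_add]; exact add_mem hp hq
  | mul_X p v hp => rw [map_mul]; exact mul_mem hp (h v)

variable {K k a l} in
theorem coordDer_ext {D D' : Derivation K (CoordRing K k a l) (CoordRing K k a l)}
    (h : ∀ v, D (coordVar K k a l v) = D' (coordVar K k a l v)) : D = D' := by
  ext b
  have : b ∈ kerSubalgebra (D - D') := eq_top_of_coordVar_mem K k a l
    (fun v => by rw [mem_kerSubalgebra, Derivation.sub_apply, h v, sub_self]) b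
  rwa [mem_kerSubalgebra, Derivation.sub_apply, sub_eq_zero] at this

variable {K k a l} in
theorem apply_coordMono_eq_zero {D : Derivation K (CoordRing K k a l) (CoordRing K k a l)}
    {ν : Var k m n →₀ ℕ} (h : ∀ v, ν v ≠ 0 → D (coordVar K k a l v) = 0) :
    D (coordMono K k a l ν) = 0 := by
  rw [coordMono_eq_prod, ← mem_kerSubalgebra]
  refine prod_mem fun v _ => ?_
  by_cases hv : ν v = 0
  · rw [hv, pow_zero]; exact one_mem _
  · exact pow_mem (mem_kerSubalgebra.2 (h v hv)) _

/-- Evaluation of regular functions at a point of the hypersurface. -/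
noncomputable def evalAt (p : Var k m n → K) (hp : aeval p (defPoly K k a l) = 0) :
    CoordRing K k a l →ₐ[K] K :=
  Ideal.Quotient.liftₐ _ (aeval p) (fun q hq => by
    obtain ⟨r, rfl⟩ := Ideal.mem_span_singleton'.mp hq
    rw [map_mul, hp, mul_zero])

theorem evalAt_coordVar (p : Var k m n → K) (hp : aeval p (defPoly K k a l) = 0)
    (v : Var k m n) : evalAt K k a l p hp (coordVar K k a l v) = p v := by
  have : evalAt K k a l p hp (coordVar K k a l v) = aeval p (X v) := rfl
  rw [this, aeval_X]

theorem coordVar_ne_zero [CharZero K] (hk : 1 ≤ k) (v : Var k m n) : coordVar K k a l v ≠ 0 := by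
  -- The point with one x equal to 2 and all other coordinates 1 lies on the hypersurface, since 2 =
  -- 1 + 1, and no coordinate vanishes there.
  have hp : aeval (fun v : Var k m n => if v = vx ⟨0, hk⟩ then (2 : K) else 1)
      (defPoly K k a l) = 0 := by
    rw [defPoly]
    simp only [map_sub, map_mul, map_prod, map_pow, aeval_X, map_add, map_one]
    simp [vx, vy, vz]
    norm_num
  intro h
  have := evalAt_coordVar K k a l _ hp v
  rw [h, map_zero] at this
  split_ifs at this <;> simp at this

theorem not_isUnit_coordVar_vz (hl : ∀ j, 1 < l j) (j : Fin n) :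
    ¬ IsUnit (coordVar K k a l (vz j)) := by
  -- The point x = y = 1, z = 0 lies on the hypersurface, and every z_j vanishes there.
  have hp : aeval (Sum.elim (fun _ => 1) (Sum.elim (fun _ => 1) (fun _ => 0)) : Var k m n → K)
      (defPoly K k a l) = 0 := by
    have hz : ∏ j : Fin n, (0 : K) ^ l j = 0 :=
      Finset.prod_eq_zero (Finset.mem_univ j) (zero_pow (by have := hl j; omega))
    rw [defPoly]
    simp only [map_sub, map_mul, map_prod, map_pow, aeval_X, map_add, map_one]
    simp [vx, vy, vz, hz]
  intro h
  have := (h.map (evalAt K k a l _ hp)).ne_zero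
  rw [evalAt_coordVar] at this
  exact this rfl

/-- The polynomial is linear in one x, of the form w x + g. Here w is a product of variables, and g
has nonzero constant term, so no variable divides it; thus w and g are coprime. -/
theorem irreducible_defPoly (hk : 1 ≤ k) (hn : 1 < n) (hl : ∀ j, 1 < l j) :
    Irreducible (defPoly K k a l) := by
  classical
  set i : Fin k := ⟨0, hk⟩
  set w : MvPolynomial (Var k m n) K :=
    (∏ s ∈ Finset.univ.erase i, X (vx s)) * ∏ s : Fin m, X (vy s) ^ a s with hw
  set g : MvPolynomial (Var k m n) K := - ((∏ j : Fin n, X (vz j) ^ l j) + 1) with hg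
  have heq : defPoly K k a l = w * X (vx i) + g := by
    rw [defPoly, ← Finset.mul_prod_erase Finset.univ _ (Finset.mem_univ i), hw, hg]
    ring
  have hg0 : aeval (0 : Var k m n → K) g ≠ 0 := by
    have hz : ∏ j : Fin n, (0 : K) ^ l j = 0 :=
      Finset.prod_eq_zero (Finset.mem_univ ⟨0, by omega⟩)
        (zero_pow (by have := hl ⟨0, by omega⟩; omega))
    simp [hg, hz]
  have hX : ∀ v : Var k m n, IsRelPrime (X v) g := by
    intro v
    rw [(X_prime (i := v)).irreducible.isRelPrime_iff_not_dvd]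
    rintro ⟨q, hq⟩
    apply hg0
    rw [hq, map_mul, aeval_X, Pi.zero_apply, zero_mul]
  rw [heq]
  refine irreducible_mul_X_add w g (vx i) ?_ ?_ ?_ ?_
  · exact mul_ne_zero (Finset.prod_ne_zero_iff.2 fun _ _ => X_ne_zero _)
      (Finset.prod_ne_zero_iff.2 fun _ _ => pow_ne_zero _ (X_ne_zero _))
  · intro h
    rcases Finset.mem_union.1 (vars_mul _ _ h) with h | h
    · obtain ⟨s, hs, h⟩ := Finset.mem_biUnion.1 (vars_prod _ h)
      rw [vars_X, Finset.mem_singleton] at h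
      exact (Finset.mem_erase.1 hs).1 (Sum.inl_injective h).symm
    · obtain ⟨s, hs, h⟩ := Finset.mem_biUnion.1 (vars_prod _ h)
      have := vars_pow _ _ h
      rw [vars_X, Finset.mem_singleton] at this
      exact Sum.inl_ne_inr this
  · rw [hg, vars_neg]
    intro h
    rcases Finset.mem_union.1 (vars_add_subset _ _ h) with h | h
    · obtain ⟨s, hs, h⟩ := Finset.mem_biUnion.1 (vars_prod _ h)
      have := vars_pow _ _ h
      rw [vars_X, Finset.mem_singleton] at this
      exact Sum.inl_ne_inr this
    · simp at h
  · exact IsRelPrime.mul_left (IsRelPrime.prod_left fun _ _ => hX _)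
      (IsRelPrime.prod_left fun _ _ => (hX _).pow_left)

theorem isDomain_coordRing (hk : 1 ≤ k) (hn : 1 < n) (hl : ∀ j, 1 < l j) :
    IsDomain (CoordRing K k a l) := by
  have hirr := irreducible_defPoly K k a l hk hn hl
  rw [Ideal.Quotient.isDomain_iff_prime, Ideal.span_singleton_prime hirr.ne_zero]
  exact hirr.prime

end Coordinates

/-! ### The derivations ∂_{ij} and their multiples -/

section Partial

open MvPolynomial

variable (K : Type*) [Field K] (k : ℕ) {m n : ℕ} (a : Fin m → ℕ) (l : Fin n → ℕ)

theorem coordMono_ne_zero [IsDomain (CoordRing K k a l)] [CharZero K] (hk : 1 ≤ k)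
    (ν : Var k m n →₀ ℕ) : coordMono K k a l ν ≠ 0 := by
  rw [coordMono_eq_prod]
  exact Finset.prod_ne_zero_iff.2 fun v _ => pow_ne_zero _ (coordVar_ne_zero K k a l hk v)

/-- The class of `y^a ∏_{s ≠ i} x_s`. -/
noncomputable abbrev cofactorX (i : Fin k) : CoordRing K k a l :=
  coordMono K k a l ((natLeft k a n).erase (vx i))

/-- The class of `∏_{s ≠ j} z_s^{l_s}`. -/
noncomputable abbrev cofactorZ (j : Fin n) : CoordRing K k a l :=
  coordMono K k a l ((natRight k l m).erase (vz j))

/-- This is a Bezout identity: it makes `cofactorX` coprime to z_j. Most of the divisibility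
arguments below multiply through by it. -/
theorem cofactor_relation (i : Fin k) (j : Fin n) :
    cofactorX K k a l i * coordVar K k a l (vx i) =
      cofactorZ K k a l j * coordVar K k a l (vz j) ^ l j + 1 := by
  have h := coordMono_natLeft K k a l
  rw [coordMono_eq_mul_erase K k a l (natLeft k a n) (vx i),
    coordMono_eq_mul_erase K k a l (natRight k l m) (vz j), natLeft_vx, natRight_vz, pow_one] at h
  exact h

theorem vx_injective : Function.Injective (vx : Fin k → Var k m n) := Sum.inl_injective

theorem vz_injective : Function.Injective (vz : Fin n → Var k m n) :=
  Sum.inr_injective.comp Sum.inr_injective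

theorem partialDer_vz (i : Fin k) (j : Fin n) :
    partialDer K k a l i j (coordVar K k a l (vz j)) = cofactorX K k a l i := by
  rw [partialDer_toCoord, polyDer, mkDerivation_X, vz, Sum.elim_inr, Sum.elim_inr, if_pos rfl,
    cofactorX, coordMono_eq_prod, prod_pow_sum, ← Finset.mul_prod_erase Finset.univ
      (fun s => coordVar K k a l (vx s) ^ _) (Finset.mem_univ i)]
  have h1 : ∀ s : Fin m, (natLeft k a n).erase (vx i) (vy s) = a s := fun s => by
    rw [Finsupp.erase_ne (by simp [vx, vy]), natLeft_vy]
  have h2 : ∀ j : Fin n, (natLeft k a n).erase (vx i) (vz j) = 0 := fun j => by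
    rw [Finsupp.erase_ne (by simp [vx, vz]), natLeft_vz]
  have h3 : ∀ s ∈ Finset.univ.erase i, coordVar K k a l (vx s) ^
      (natLeft k a n).erase (vx i) (vx s) = coordVar K k a l (vx s) := fun s hs => by
    rw [Finsupp.erase_ne ((vx_injective k).ne (Finset.ne_of_mem_erase hs)), natLeft_vx, pow_one]
  rw [Finset.prod_congr rfl h3]
  simp only [h1, h2, Finsupp.erase_same, map_mul, map_prod, map_pow, pow_zero,
    Finset.prod_const_one, mul_one, one_mul]
  exact mul_comm _ _

theorem partialDer_vx (i : Fin k) (j : Fin n) :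
    partialDer K k a l i j (coordVar K k a l (vx i)) =
      (l j : CoordRing K k a l) * coordVar K k a l (vz j) ^ (l j - 1) * cofactorZ K k a l j := by
  rw [partialDer_toCoord, polyDer, mkDerivation_X, vx, Sum.elim_inl, if_pos rfl,
    cofactorZ, coordMono_eq_prod, prod_pow_sum, ← Finset.mul_prod_erase Finset.univ
      (fun s => coordVar K k a l (vz s) ^ _) (Finset.mem_univ j)]
  have h1 : ∀ s : Fin m, (natRight k l m).erase (vz j) (vy s) = 0 := fun s => by
    rw [Finsupp.erase_ne (by simp [vy, vz]), natRight_vy]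
  have h2 : ∀ s : Fin k, (natRight k l m).erase (vz j) (vx s) = 0 := fun j => by
    rw [Finsupp.erase_ne (by simp [vx, vz]), natRight_vx]
  have h3 : ∀ s ∈ Finset.univ.erase j, coordVar K k a l (vz s) ^
      (natRight k l m).erase (vz j) (vz s) = coordVar K k a l (vz s) ^ l s := fun s hs => by
    rw [Finsupp.erase_ne ((vz_injective k).ne (Finset.ne_of_mem_erase hs)), natRight_vz]
  rw [Finset.prod_congr rfl h3]
  simp only [h1, h2, Finsupp.erase_same, map_mul, map_prod, map_pow, pow_zero, map_natCast,
    Finset.prod_const_one, one_mul]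

theorem partialDer_of_ne (i : Fin k) (j : Fin n) {v : Var k m n} (hx : v ≠ vx i) (hz : v ≠ vz j) :
    partialDer K k a l i j (coordVar K k a l v) = 0 := by
  rw [partialDer_toCoord, polyDer, mkDerivation_X]
  rcases v with r | r | r
  · rw [Sum.elim_inl, if_neg, map_zero]
    rintro rfl
    exact hx rfl
  · exact map_zero _
  · rw [Sum.elim_inr, Sum.elim_inr, if_neg, map_zero]
    rintro rfl
    exact hz rfl

section

variable {K k a l}

theorem apply_cofactorX_eq_zero {D : Derivation K (CoordRing K k a l) (CoordRing K k a l)}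
    {i : Fin k} {j : Fin n} (h : ∀ v, v ≠ vx i → v ≠ vz j → D (coordVar K k a l v) = 0) :
    D (cofactorX K k a l i) = 0 := by
  refine apply_coordMono_eq_zero fun v hv => ?_
  have hx : v ≠ vx i := by
    rintro rfl
    exact hv Finsupp.erase_same
  refine h v hx ?_
  rintro rfl
  rw [Finsupp.erase_ne hx] at hv
  exact hv rfl

theorem apply_cofactorZ_eq_zero {D : Derivation K (CoordRing K k a l) (CoordRing K k a l)}
    {i : Fin k} {j : Fin n} (h : ∀ v, v ≠ vx i → v ≠ vz j → D (coordVar K k a l v) = 0) :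
    D (cofactorZ K k a l j) = 0 := by
  refine apply_coordMono_eq_zero fun v hv => ?_
  have hz : v ≠ vz j := by
    rintro rfl
    exact hv Finsupp.erase_same
  refine h v ?_ hz
  rintro rfl
  rw [Finsupp.erase_ne hz] at hv
  exact hv rfl

theorem cofactor_derivation {D : Derivation K (CoordRing K k a l) (CoordRing K k a l)}
    {i : Fin k} {j : Fin n} (h : ∀ v, v ≠ vx i → v ≠ vz j → D (coordVar K k a l v) = 0) :
    cofactorX K k a l i * D (coordVar K k a l (vx i)) =
      (l j : CoordRing K k a l) * coordVar K k a l (vz j) ^ (l j - 1) * cofactorZ K k a l j *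
        D (coordVar K k a l (vz j)) := by
  have hD := congrArg D (cofactor_relation K k a l i j)
  rw [Derivation.leibniz, map_add, Derivation.leibniz, Derivation.leibniz_pow,
    apply_cofactorX_eq_zero h, apply_cofactorZ_eq_zero h, Derivation.map_one_eq_zero] at hD
  simp only [smul_eq_mul, nsmul_eq_mul, mul_zero, add_zero] at hD
  rw [hD]
  ring

/-- Differentiating the relation leaves `cofactorX` times D(x_i) equal to zero, in a domain. -/
theorem eq_zero_of_forall_ne_vx [IsDomain (CoordRing K k a l)] [CharZero K] (hk : 1 ≤ k)
    (hn : 1 < n) {D : Derivation K (CoordRing K k a l) (CoordRing K k a l)}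
    {i : Fin k} (h : ∀ v, v ≠ vx i → D (coordVar K k a l v) = 0) : D = 0 := by
  refine coordDer_ext fun v => ?_
  rw [Derivation.zero_apply]
  by_cases hv : v = vx i
  · subst hv
    have := cofactor_derivation (i := i) (j := ⟨0, by omega⟩) (fun v hv _ => h v hv)
    rw [h (vz _) Sum.inr_ne_inl, mul_zero] at this
    exact (mul_eq_zero.1 this).resolve_left (coordMono_ne_zero K k a l hk _)
  · exact h v hv

/-- A derivation killing all variables except `x_i` and `z_j` is a multiple of `∂_{ij}`. -/
theorem eq_smul_partialDer [CharZero K]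
    {D : Derivation K (CoordRing K k a l) (CoordRing K k a l)} {i : Fin k} {j : Fin n}
    (hl : l j ≠ 0) (h : ∀ v, v ≠ vx i → v ≠ vz j → D (coordVar K k a l v) = 0) :
    D = (coordVar K k a l (vx i) * D (coordVar K k a l (vz j)) - algebraMap K _ (l j : K)⁻¹ *
      (coordVar K k a l (vz j) * D (coordVar K k a l (vx i)))) • partialDer K k a l i j := by
  -- The factor is forced: if D = h ∂_{ij}, then x_i D(z_j) - l_j⁻¹ z_j D(x_i) equals h times x_i
  -- ∂_{ij}(z_j) - l_j⁻¹ z_j ∂_{ij}(x_i), and the latter is 1. The checks on x_i and z_j combine the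
  -- relation with its derivative.
  have hR := cofactor_relation K k a l i j
  have hD := cofactor_derivation h
  have hc : algebraMap K (CoordRing K k a l) (l j : K)⁻¹ * (l j : CoordRing K k a l) = 1 :=
    algebraMap_inv_mul_natCast hl
  have hpow : coordVar K k a l (vz j) ^ l j =
      coordVar K k a l (vz j) ^ (l j - 1) * coordVar K k a l (vz j) := by
    rw [← pow_succ, Nat.sub_add_cancel (Nat.one_le_iff_ne_zero.2 hl)]
  rw [hpow] at hR
  refine coordDer_ext fun v => ?_
  rw [Derivation.smul_apply, smul_eq_mul]
  by_cases hx : v = vx i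
  · subst hx
    rw [partialDer_vx]
    linear_combination (-D (coordVar K k a l (vx i))) * hR
      + coordVar K k a l (vx i) * hD + (coordVar K k a l (vz j) * D (coordVar K k a l (vx i)) *
        coordVar K k a l (vz j) ^ (l j - 1) * cofactorZ K k a l j) * hc
  by_cases hz : v = vz j
  · subst hz
    rw [partialDer_vz]
    linear_combination (-D (coordVar K k a l (vz j))) * hR
      + (algebraMap K _ (l j : K)⁻¹ * coordVar K k a l (vz j)) * hD +
      (coordVar K k a l (vz j) * D (coordVar K k a l (vz j)) *
        coordVar K k a l (vz j) ^ (l j - 1) * cofactorZ K k a l j) * hc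
  · rw [h v hx hz, partialDer_of_ne K k a l i j hx hz, mul_zero]

end

/-- The derivation is triangular: z_j goes to a kernel element, and x_i to a polynomial in z_j with
kernel coefficients. Nilpotent elements form a subalgebra, so the variables suffice. -/
theorem isLND_partialDer (i : Fin k) (j : Fin n) : IsLND (partialDer K k a l i j) := by
  set δ := partialDer K k a l i j
  have hne : ∀ v, v ≠ vx i → v ≠ vz j → coordVar K k a l v ∈ nilSubalgebra δ := fun v hx hz =>
    ⟨1, partialDer_of_ne K k a l i j hx hz⟩
  have hzj : coordVar K k a l (vz j) ∈ nilSubalgebra δ := by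
    refine ⟨2, ?_⟩
    rw [Function.iterate_succ_apply, partialDer_vz]
    exact apply_cofactorX_eq_zero fun v hx hz => partialDer_of_ne K k a l i j hx hz
  refine fun b => eq_top_of_coordVar_mem K k a l (S := nilSubalgebra δ) (fun v => ?_) b
  by_cases hz : v = vz j
  · exact hz ▸ hzj
  by_cases hx : v = vx i
  · subst hx
    refine mem_nilSubalgebra_of_apply_mem ?_
    rw [partialDer_vx]
    refine mul_mem (mul_mem (natCast_mem _ _) (pow_mem hzj _)) ⟨1, ?_⟩
    exact apply_cofactorZ_eq_zero fun v hx hz => partialDer_of_ne K k a l i j hx hz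
  · exact hne v hx hz

/-- The values ∂_{ij}(z_j) and ∂_{ij}(x_i) generate the unit ideal, with coefficients x_i and -l_j⁻¹
z_j. This yields both irreducibility and the divisibility h ∣ D(h) for derivations D commuting with
h ∂_{ij}. -/
theorem dvd_of_forall_dvd_mul_partialDer [CharZero K] {i : Fin k} {j : Fin n} (hl : l j ≠ 0)
    {h b : CoordRing K k a l} (hb : ∀ c, h ∣ b * partialDer K k a l i j c) : h ∣ b := by
  have hR := cofactor_relation K k a l i j
  have hc : algebraMap K (CoordRing K k a l) (l j : K)⁻¹ * (l j : CoordRing K k a l) = 1 :=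
    algebraMap_inv_mul_natCast hl
  have hpow : coordVar K k a l (vz j) ^ l j =
      coordVar K k a l (vz j) ^ (l j - 1) * coordVar K k a l (vz j) := by
    rw [← pow_succ, Nat.sub_add_cancel (Nat.one_le_iff_ne_zero.2 hl)]
  rw [hpow] at hR
  have h1 := hb (coordVar K k a l (vz j))
  have h2 := hb (coordVar K k a l (vx i))
  rw [partialDer_vz] at h1
  rw [partialDer_vx] at h2
  have := (h1.mul_right (coordVar K k a l (vx i))).sub
    (h2.mul_right (algebraMap K (CoordRing K k a l) (l j : K)⁻¹ * coordVar K k a l (vz j)))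
  convert this using 1
  linear_combination (-b) * hR +
    (b * coordVar K k a l (vz j) ^ (l j - 1) * coordVar K k a l (vz j) * cofactorZ K k a l j) * hc

theorem isIrreducibleDer_partialDer [CharZero K] (i : Fin k) {j : Fin n} (hl : l j ≠ 0) :
    IsIrreducibleDer (partialDer K k a l i j) := by
  rintro I ⟨⟨g, rfl⟩⟩ htop hsub
  apply htop
  rw [Ideal.submodule_span_eq, Ideal.span_singleton_eq_top, isUnit_iff_dvd_one]
  refine dvd_of_forall_dvd_mul_partialDer K k a l hl (i := i) (j := j) fun c => ?_
  rw [one_mul, ← Ideal.mem_span_singleton]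
  exact hsub ⟨c, rfl⟩

/-- With i shared, both derivations send variables other than x_i to 0 or to the same `cofactorX`,
which both kill. The commutator can then only move x_i, so it vanishes. -/
theorem partialDer_commute [IsDomain (CoordRing K k a l)] [CharZero K] (hk : 1 ≤ k) (hn : 1 < n)
    (i : Fin k) (j s : Fin n) : ⁅partialDer K k a l i j, partialDer K k a l i s⁆ = 0 := by
  have hX : ∀ j, partialDer K k a l i j (cofactorX K k a l i) = 0 := fun j =>
    apply_cofactorX_eq_zero fun v hx hz => partialDer_of_ne K k a l i j hx hz
  have hv : ∀ (j s : Fin n) (v : Var k m n), v ≠ vx i →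
      partialDer K k a l i j (partialDer K k a l i s (coordVar K k a l v)) = 0 := by
    intro j s v hv
    by_cases hs : v = vz s
    · rw [hs, partialDer_vz, hX]
    · rw [partialDer_of_ne K k a l i s hv hs, map_zero]
  refine eq_zero_of_forall_ne_vx hk hn (i := i) fun v hx => ?_
  rw [Derivation.commutator_apply, hv j s v hx, hv s j v hx, sub_zero]

end Partial

/-! ### The grading of the coordinate ring and the shape of homogeneous elements -/

section Grading

open MvPolynomial

variable (K : Type*) [Field K] (k : ℕ) {m n : ℕ} (a : Fin m → ℕ) (l : Fin n → ℕ)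

/-- The degree of a monomial in the grading group. -/
noncomputable abbrev monoDeg (ν : Var k m n →₀ ℕ) : GradingGroup k a l :=
  Finsupp.weight (degVar k a l) ν

/-- The homogeneous regular functions of degree `g`. -/
noncomputable def homogPart (g : GradingGroup k a l) : Submodule K (CoordRing K k a l) :=
  (weightedHomogeneousSubmodule K (degVar k a l) g).map (toCoord K k a l).toLinearMap

theorem monoDeg_eq_mk (ν : Var k m n →₀ ℕ) :
    monoDeg k a l ν = Submodule.Quotient.mk (fun v => (ν v : ℤ)) := by
  rw [monoDeg, Finsupp.weight_apply,
    Finsupp.sum_fintype _ _ (fun v => zero_smul ℕ (degVar k a l v))]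
  have : (fun v => (ν v : ℤ)) = ∑ v, ν v • (Pi.single v 1 : Var k m n → ℤ) := by
    ext u
    simp [Finset.sum_apply, Pi.single_apply]
  rw [this, ← Submodule.mkQ_apply, map_sum]
  simp only [map_nsmul]
  rfl

theorem expLeft_eq (v : Var k m n) : expLeft k a (n := n) v = natLeft k a n v := by
  rcases v with v | v | v <;> rfl

theorem expRight_eq (v : Var k m n) : expRight k m l v = natRight k l m v := by
  rcases v with v | v | v <;> rfl

theorem mk_eq_mk_iff (p q : Var k m n → ℤ) :
    (Submodule.Quotient.mk p : GradingGroup k a l) = Submodule.Quotient.mk q ↔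
      ∃ α β : ℤ, ∀ v, p v = q v + α * natLeft k a n v + β * natRight k l m v := by
  rw [Submodule.Quotient.eq, Submodule.mem_span_pair]
  refine exists_congr fun α => exists_congr fun β => ?_
  rw [funext_iff]
  refine forall_congr' fun v => ?_
  simp only [Pi.add_apply, Pi.smul_apply, Pi.sub_apply, smul_eq_mul, expLeft_eq, expRight_eq]
  constructor <;> intro h <;> linarith

theorem monoDeg_natLeft : monoDeg k a l (natLeft k a n) = 0 := by
  rw [monoDeg_eq_mk, ← Submodule.Quotient.mk_zero, mk_eq_mk_iff]
  exact ⟨1, 0, fun v => by simp⟩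

theorem monoDeg_natRight : monoDeg k a l (natRight k l m) = 0 := by
  rw [monoDeg_eq_mk, ← Submodule.Quotient.mk_zero, mk_eq_mk_iff]
  exact ⟨0, 1, fun v => by simp⟩

theorem defPoly_eq_monomial :
    defPoly K k a l = monomial (natLeft k a n) 1 - (monomial (natRight k l m) 1 + 1) := by
  rw [monomial_eq, monomial_eq, C_1, one_mul, one_mul,
    Finsupp.prod_fintype _ _ (fun _ => pow_zero _), Finsupp.prod_fintype _ _ (fun _ => pow_zero _),
    prod_pow_sum, prod_pow_sum]
  simp only [natLeft_vx, natLeft_vy, natLeft_vz, natRight_vx, natRight_vy, natRight_vz, pow_one,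
    pow_zero, Finset.prod_const_one, mul_one, one_mul]
  rfl

theorem isWeightedHomogeneous_defPoly :
    IsWeightedHomogeneous (degVar k a l) (defPoly K k a l) 0 := by
  rw [defPoly_eq_monomial]
  exact (isWeightedHomogeneous_monomial _ _ _ (monoDeg_natLeft k a l)).sub
    ((isWeightedHomogeneous_monomial _ _ _ (monoDeg_natRight k a l)).add
      (isWeightedHomogeneous_one K _))

variable {K k a l}

theorem isHomogElem_iff {b : CoordRing K k a l} :
    IsHomogElem b ↔ ∃ g, b ∈ homogPart K k a l g :=
  ⟨fun ⟨p, ⟨g, hg⟩, h⟩ => ⟨g, p, hg, h⟩, fun ⟨g, p, hg, h⟩ => ⟨p, ⟨g, hg⟩, h⟩⟩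

theorem mul_mem_homogPart {g g' : GradingGroup k a l} {b c : CoordRing K k a l}
    (hb : b ∈ homogPart K k a l g) (hc : c ∈ homogPart K k a l g') :
    b * c ∈ homogPart K k a l (g + g') := by
  obtain ⟨p, hp, rfl⟩ := hb
  obtain ⟨q, hq, rfl⟩ := hc
  exact ⟨p * q, IsWeightedHomogeneous.mul hp hq, map_mul (toCoord K k a l) p q⟩

theorem coordMono_mem_homogPart (ν : Var k m n →₀ ℕ) :
    coordMono K k a l ν ∈ homogPart K k a l (monoDeg k a l ν) :=
  ⟨_, isWeightedHomogeneous_monomial _ _ _ rfl, rfl⟩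

theorem coordVar_mem_homogPart (v : Var k m n) :
    coordVar K k a l v ∈ homogPart K k a l (degVar k a l v) :=
  ⟨_, isWeightedHomogeneous_X _ _ _, rfl⟩

attribute [local instance] MvPolynomial.weightedGradedAlgebra

/-- The sum of the homogeneous parts is direct. -/
theorem eq_zero_of_sum_homogPart_eq_zero (S : Finset (GradingGroup k a l))
    (b : GradingGroup k a l → CoordRing K k a l) (hb : ∀ g ∈ S, b g ∈ homogPart K k a l g)
    (hsum : ∑ g ∈ S, b g = 0) : ∀ g ∈ S, b g = 0 := by
  classical
  have hex : ∀ g, ∃ p : MvPolynomial (Var k m n) K, g ∈ S →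
      IsWeightedHomogeneous (degVar k a l) p g ∧ toCoord K k a l p = b g := fun g => by
    by_cases hg : g ∈ S
    · obtain ⟨p, hp, h⟩ := hb g hg
      exact ⟨p, fun _ => ⟨hp, h⟩⟩
    · exact ⟨0, fun h => absurd h hg⟩
  choose p hp using hex
  intro g hg
  have hmem : ∑ g ∈ S, p g ∈ Ideal.span {defPoly K k a l} := by
    rw [← Ideal.Quotient.eq_zero_iff_mem]
    change toCoord K k a l _ = 0
    rw [map_sum, Finset.sum_congr rfl fun g hg => (hp g hg).2, hsum]
  have hI : (Ideal.span {defPoly K k a l}).IsHomogeneous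
      (weightedHomogeneousSubmodule K (degVar k a l)) := by
    refine Ideal.homogeneous_span _ _ ?_
    rintro _ rfl
    exact ⟨0, isWeightedHomogeneous_defPoly K k a l⟩
  -- The defining polynomial is homogeneous of degree 0, so its ideal contains the components of its
  -- elements; the component of degree g here is `p g`.
  have hcomp := weightedHomogeneousComponent_mem_of_mem K (degVar k a l) hI hmem g
  rw [map_sum, Finset.sum_eq_single_of_mem g hg
    (fun g' hg' hne => (hp g' hg').1.weightedHomogeneousComponent_ne _ hne.symm),
    (hp g hg).1.weightedHomogeneousComponent_same] at hcomp
  rw [← (hp g hg).2]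
  exact Ideal.Quotient.eq_zero_iff_mem.2 hcomp

theorem eq_zero_of_mem_homogPart {g g' : GradingGroup k a l} (hne : g ≠ g')
    {b : CoordRing K k a l} (hb : b ∈ homogPart K k a l g) (hb' : b ∈ homogPart K k a l g') :
    b = 0 := by
  classical
  have := eq_zero_of_sum_homogPart_eq_zero {g, g'} (fun h => if h = g then b else -b)
    (by
      intro h hh
      rcases Finset.mem_insert.1 hh with rfl | hh
      · simpa using hb
      · obtain rfl := Finset.mem_singleton.1 hh
        simpa [hne.symm] using hb')
    (by rw [Finset.sum_pair hne]; simp [hne.symm]) g (Finset.mem_insert_self _ _)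
  simpa using this

theorem eq_zero_of_add_mem_homogPart {g g' g'' : GradingGroup k a l} (hne : g ≠ g')
    {b c : CoordRing K k a l} (hb : b ∈ homogPart K k a l g) (hc : c ∈ homogPart K k a l g')
    (hbc : b + c ∈ homogPart K k a l g'') : b = 0 ∨ c = 0 := by
  classical
  by_cases h1 : g'' = g
  · subst h1
    right
    refine eq_zero_of_mem_homogPart hne ?_ hc
    simpa using sub_mem hbc hb
  by_cases h2 : g'' = g'
  · subst h2
    left
    refine eq_zero_of_mem_homogPart hne hb ?_
    simpa using sub_mem hbc hc
  have := eq_zero_of_sum_homogPart_eq_zero {g, g', g''}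
    (fun h => if h = g then b else if h = g' then c else -(b + c))
    (by
      intro h hh
      rcases Finset.mem_insert.1 hh with rfl | hh
      · simpa using hb
      rcases Finset.mem_insert.1 hh with rfl | hh
      · simpa [hne.symm] using hc
      · obtain rfl := Finset.mem_singleton.1 hh
        simp only [if_neg h1, if_neg h2]
        exact neg_mem hbc)
    (by
      rw [Finset.sum_insert (by simp [hne, Ne.symm h1]), Finset.sum_pair (Ne.symm h2)]
      simp [hne.symm, h1, h2]) g (Finset.mem_insert_self _ _)
  left
  simpa using this

theorem exists_sum_homogPart (b : CoordRing K k a l) :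
    ∃ (S : Finset (GradingGroup k a l)) (c : GradingGroup k a l → CoordRing K k a l),
      (∀ g, c g ∈ homogPart K k a l g) ∧ b = ∑ g ∈ S, c g := by
  classical
  obtain ⟨p, rfl⟩ := Ideal.Quotient.mkₐ_surjective K _ b
  have hfin := weightedHomogeneousComponent_finsupp (w := degVar k a l) p
  refine ⟨hfin.toFinset, fun g => toCoord K k a l (weightedHomogeneousComponent _ g p),
    fun g => ⟨_, weightedHomogeneousComponent_isWeightedHomogeneous g p, rfl⟩, ?_⟩
  rw [← map_sum]
  congr 1
  have := finsum_weightedHomogeneousComponent (w := degVar k a l) p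
  rw [finsum_eq_sum _ hfin] at this
  exact this.symm

theorem natLeft_eq_zero_or (v : Var k m n) : natLeft k a n v = 0 ∨ natRight k l m v = 0 := by
  rcases v with v | v | v
  · exact Or.inr rfl
  · exact Or.inr rfl
  · exact Or.inl rfl

/-- Two monomials of the same degree have a common divisor of that degree, with quotients that are
products of powers of the two monomials of degree zero. -/
theorem exists_common_of_monoDeg_eq {ν μ : Var k m n →₀ ℕ}
    (h : monoDeg k a l ν = monoDeg k a l μ) :
    ∃ (κ : Var k m n →₀ ℕ) (p q p' q' : ℕ), ν = κ + (p • natLeft k a n + q • natRight k l m) ∧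
      μ = κ + (p' • natLeft k a n + q' • natRight k l m) := by
  rw [monoDeg_eq_mk, monoDeg_eq_mk, mk_eq_mk_iff] at h
  obtain ⟨α, β, h⟩ := h
  -- The two exponent vectors have disjoint supports, so the positive parts of α and β can be
  -- subtracted from ν independently. The negative parts then account for μ.
  have hle : ∀ v, α.toNat * natLeft k a n v + β.toNat * natRight k l m v ≤ ν v := by
    intro v
    have := h v
    zify
    rcases natLeft_eq_zero_or (a := a) (l := l) v with h0 | h0 <;> rw [h0] at this ⊢ <;>
      simp only [Nat.cast_zero, mul_zero, add_zero, zero_add] at this ⊢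
    · rcases le_total 0 β with hβ | hβ
      · rw [Int.toNat_of_nonneg hβ]; omega
      · rw [Int.toNat_of_nonpos hβ]; simp
    · rcases le_total 0 α with hβ | hβ
      · rw [Int.toNat_of_nonneg hβ]; omega
      · rw [Int.toNat_of_nonpos hβ]; simp
  refine ⟨ν - (α.toNat • natLeft k a n + β.toNat • natRight k l m), α.toNat, β.toNat,
    (-α).toNat, (-β).toNat, ?_, ?_⟩
  · ext v
    have := hle v
    simp only [Finsupp.add_apply, Finsupp.tsub_apply, Finsupp.smul_apply, smul_eq_mul]
    omega
  · ext v
    have h1 := hle v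
    have h2 := h v
    have hα := Int.toNat_sub_toNat_neg α
    have hβ := Int.toNat_sub_toNat_neg β
    simp only [Finsupp.add_apply, Finsupp.tsub_apply, Finsupp.smul_apply, smul_eq_mul]
    zify [h1]
    rw [h2]
    linear_combination (natLeft k a n v : ℤ) * hα + (natRight k l m v : ℤ) * hβ

/-- A nonzero homogeneous regular function is a monomial times a polynomial in `z^l`. -/
theorem exists_coordMono_mul_aeval {g : GradingGroup k a l} {b : CoordRing K k a l}
    (hb : b ∈ homogPart K k a l g) (hb0 : b ≠ 0) :
    ∃ (μ : Var k m n →₀ ℕ) (f : Polynomial K), monoDeg k a l μ = g ∧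
      b = coordMono K k a l μ * Polynomial.aeval (coordMono K k a l (natRight k l m)) f := by
  obtain ⟨p, hp, rfl⟩ := hb
  suffices h : toCoord K k a l p = 0 ∨ ∃ (μ : Var k m n →₀ ℕ) (f : Polynomial K),
      monoDeg k a l μ = g ∧ toCoord K k a l p =
        coordMono K k a l μ * Polynomial.aeval (coordMono K k a l (natRight k l m)) f from
    h.resolve_left hb0
  clear hb0
  have hp' : IsWeightedHomogeneous (degVar k a l) p g := hp
  clear hp
  induction hp' using IsWeightedHomogeneous.induction_on with
  | zero => exact Or.inl (map_zero _)
  | monomial d r hr =>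
    refine Or.inr ⟨d, Polynomial.C r, hr, ?_⟩
    rw [toCoord_monomial, Polynomial.aeval_C, mul_comm]
  | add p q _ _ ihp ihq =>
    rcases ihp with hp | ⟨μ, f, hμ, hp⟩
    · rw [map_add, hp, zero_add]; exact ihq
    rcases ihq with hq | ⟨ν, f', hν, hq⟩
    · rw [map_add, hq, add_zero]; exact Or.inr ⟨μ, f, hμ, hp⟩
    -- The quotients by the common monomial κ are powers of x₁⋯x_k y^a = T + 1 and of z^l = T, so
    -- they are absorbed into the polynomial in T.
    obtain ⟨κ, r, s, r', s', rfl, rfl⟩ :=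
      exists_common_of_monoDeg_eq (hμ.trans hν.symm)
    refine Or.inr ⟨κ, (Polynomial.X + 1) ^ r * Polynomial.X ^ s * f +
      (Polynomial.X + 1) ^ r' * Polynomial.X ^ s' * f', ?_, ?_⟩
    · rw [← hμ]
      simp [monoDeg_natLeft, monoDeg_natRight]
    · rw [map_add, hp, hq]
      simp only [coordMono_add, coordMono_nsmul, coordMono_natLeft, map_add, map_mul, map_pow,
        Polynomial.aeval_X, map_one]
      ring

end Grading

/-! ### Kernels of homogeneous locally nilpotent derivations -/

section HomogeneousLND

open MvPolynomial

variable {K : Type*} [Field K] {k m n : ℕ} {a : Fin m → ℕ} {l : Fin n → ℕ}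

/-- The derivation `δ` raises degrees by `e`. -/
def RaisesDegree (δ : Derivation K (CoordRing K k a l) (CoordRing K k a l))
    (e : GradingGroup k a l) : Prop :=
  ∀ g b, b ∈ homogPart K k a l g → δ b ∈ homogPart K k a l (g + e)

theorem RaisesDegree.isHomogDer {δ : Derivation K (CoordRing K k a l) (CoordRing K k a l)}
    {e : GradingGroup k a l} (h : RaisesDegree δ e) : IsHomogDer δ := by
  intro b hb
  obtain ⟨g, hg⟩ := isHomogElem_iff.1 hb
  exact isHomogElem_iff.2 ⟨_, h g b hg⟩

theorem RaisesDegree.iterate {δ : Derivation K (CoordRing K k a l) (CoordRing K k a l)}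
    {e : GradingGroup k a l} (h : RaisesDegree δ e) (N : ℕ) {g : GradingGroup k a l}
    {b : CoordRing K k a l} (hb : b ∈ homogPart K k a l g) :
    δ^[N] b ∈ homogPart K k a l (g + N • e) := by
  induction N with
  | zero => simpa using hb
  | succ N ih =>
    rw [Function.iterate_succ_apply', succ_nsmul, ← add_assoc]
    exact h _ _ ih

theorem monoDeg_add (μ ν : Var k m n →₀ ℕ) :
    monoDeg k a l (μ + ν) = monoDeg k a l μ + monoDeg k a l ν :=
  map_add _ _ _

theorem monoDeg_single (v : Var k m n) :
    monoDeg k a l (Finsupp.single v 1) = degVar k a l v := by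
  rw [monoDeg, Finsupp.weight_single, one_smul]

theorem raisesDegree_of_coordVar {δ : Derivation K (CoordRing K k a l) (CoordRing K k a l)}
    {e : GradingGroup k a l}
    (h : ∀ v, δ (coordVar K k a l v) ∈ homogPart K k a l (degVar k a l v + e)) :
    RaisesDegree δ e := by
  have hmul : ∀ {g g' : GradingGroup k a l} {b c : CoordRing K k a l}, b ∈ homogPart K k a l g →
      δ b ∈ homogPart K k a l (g + e) → c ∈ homogPart K k a l g' →
      δ c ∈ homogPart K k a l (g' + e) → δ (b * c) ∈ homogPart K k a l (g + g' + e) := by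
    intro g g' b c hb hδb hc hδc
    rw [Derivation.leibniz, smul_eq_mul, smul_eq_mul]
    refine add_mem ?_ ?_
    · rw [add_assoc]; exact mul_mem_homogPart hb hδc
    · rw [show g + g' + e = g' + (g + e) by abel]; exact mul_mem_homogPart hc hδb
  have hpow : ∀ (v : Var k m n) (r : ℕ), δ (coordMono K k a l (Finsupp.single v r)) ∈
      homogPart K k a l (monoDeg k a l (Finsupp.single v r) + e) := by
    intro v r
    induction r with
    | zero =>
      rw [Finsupp.single_zero, coordMono_zero, Derivation.map_one_eq_zero]
      exact zero_mem _
    | succ r ih =>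
      rw [Finsupp.single_add, coordMono_add, monoDeg_add]
      refine hmul (coordMono_mem_homogPart _) ih (coordMono_mem_homogPart _) ?_
      rw [coordMono_single, pow_one, monoDeg_single]
      exact h v
  have hmono : ∀ ν : Var k m n →₀ ℕ,
      δ (coordMono K k a l ν) ∈ homogPart K k a l (monoDeg k a l ν + e) := by
    intro ν
    induction ν using Finsupp.induction_linear with
    | zero =>
      rw [coordMono_zero, Derivation.map_one_eq_zero]
      exact zero_mem _
    | add μ ν hμ hν =>
      rw [coordMono_add, monoDeg_add]
      exact hmul (coordMono_mem_homogPart _) hμ (coordMono_mem_homogPart _) hν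
    | single v r => exact hpow v r
  rintro g _ ⟨p, hp, rfl⟩
  have hp' : IsWeightedHomogeneous (degVar k a l) p g := hp
  clear hp
  change δ (toCoord K k a l p) ∈ _
  induction hp' using IsWeightedHomogeneous.induction_on with
  | zero => rw [map_zero, map_zero]; exact zero_mem _
  | monomial d r hr =>
    rw [toCoord_monomial, ← Algebra.smul_def, Derivation.map_smul, ← hr]
    exact Submodule.smul_mem _ _ (hmono d)
  | add p q _ _ ihp ihq =>
    rw [map_add, map_add]
    exact add_mem ihp ihq

theorem monoDeg_erase (ν : Var k m n →₀ ℕ) (v : Var k m n) :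
    monoDeg k a l (ν.erase v) = monoDeg k a l ν - ν v • degVar k a l v := by
  conv_rhs => rw [← Finsupp.erase_add_single v ν]
  simp [monoDeg, Finsupp.weight_single]

/-- Both monomials of the equation have degree 0, so deleting one factor from a monomial leaves
minus the degree of that factor. -/
theorem raisesDegree_partialDer (i : Fin k) {j : Fin n} (hl : l j ≠ 0) :
    RaisesDegree (partialDer K k a l i j) (-degVar k a l (vx i) - degVar k a l (vz j)) := by
  refine raisesDegree_of_coordVar fun v => ?_
  by_cases hx : v = vx i
  · subst hx
    rw [partialDer_vx, ← coordMono_single, mul_assoc, ← coordMono_add, ← nsmul_eq_mul]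
    refine nsmul_mem ?_ _
    convert coordMono_mem_homogPart (K := K) _ using 2
    have h1 : (Finsupp.single (vz j) (l j - 1) + (natRight k l m).erase (vz j)) +
        Finsupp.single (vz j) 1 = natRight k l m := by
      rw [add_right_comm, ← Finsupp.single_add,
        Nat.sub_add_cancel (Nat.one_le_iff_ne_zero.2 hl), add_comm]
      exact Finsupp.erase_add_single (vz j) (natRight k l m)
    have h2 := congrArg (monoDeg k a l) h1
    rw [monoDeg_add, monoDeg_natRight, monoDeg_single] at h2
    rw [eq_neg_of_add_eq_zero_left h2]
    abel
  by_cases hz : v = vz j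
  · subst hz
    rw [partialDer_vz]
    convert coordMono_mem_homogPart (K := K) _ using 2
    rw [monoDeg_erase, monoDeg_natLeft, natLeft_vx, one_nsmul]
    abel
  · rw [partialDer_of_ne K k a l i j hx hz]
    exact zero_mem _

/-- A priori the shift may depend on the element. Fix a variable v with δ(v) ≠ 0: since δ(bv) =
bδ(v) + vδ(b) is homogeneous, either the two terms have equal degree or one of them vanishes, and in
both cases δ(b) has the shift determined by v. -/
theorem IsHomogDer.exists_raisesDegree [IsDomain (CoordRing K k a l)]
    {δ : Derivation K (CoordRing K k a l) (CoordRing K k a l)} (h : IsHomogDer δ) :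
    ∃ e, RaisesDegree δ e := by
  by_cases h0 : ∀ v, δ (coordVar K k a l v) = 0
  · refine ⟨0, fun g b _ => ?_⟩
    have : δ = 0 := coordDer_ext fun v => by rw [h0 v, Derivation.zero_apply]
    rw [this, Derivation.zero_apply]
    exact zero_mem _
  push Not at h0
  obtain ⟨v, hv⟩ := h0
  obtain ⟨d, hd⟩ := isHomogElem_iff.1 (h _ (isHomogElem_iff.2 ⟨_, coordVar_mem_homogPart v⟩))
  have hv0 : coordVar K k a l v ≠ 0 := by
    intro h0
    rw [h0, map_zero] at hv
    exact hv rfl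
  refine ⟨d - degVar k a l v, fun g b hb => ?_⟩
  obtain ⟨g', hg'⟩ := isHomogElem_iff.1 (h _ (isHomogElem_iff.2 ⟨_, hb⟩))
  obtain ⟨g'', hg''⟩ := isHomogElem_iff.1
    (h _ (isHomogElem_iff.2 ⟨_, mul_mem_homogPart hb (coordVar_mem_homogPart v)⟩))
  by_cases hne : g' = g + (d - degVar k a l v)
  · exact hne ▸ hg'
  rw [Derivation.leibniz, smul_eq_mul, smul_eq_mul] at hg''
  have hne' : g + d ≠ degVar k a l v + g' := by
    intro heq
    rw [← add_sub_assoc, heq] at hne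
    exact hne (by abel)
  rcases eq_zero_of_add_mem_homogPart hne' (mul_mem_homogPart hb hd)
    (mul_mem_homogPart (coordVar_mem_homogPart v) hg') hg'' with h1 | h1
  · rw [(mul_eq_zero.1 h1).resolve_right hv, map_zero]
    exact zero_mem _
  · rw [(mul_eq_zero.1 h1).resolve_left hv0]
    exact zero_mem _

variable [CharZero K] [IsDomain (CoordRing K k a l)]

/-- If z^l were in the kernel, so would be z^l + 1 = x₁⋯x_k y^a, and factorial closedness would then
put every variable in the kernel. -/
theorem apply_natRight_ne_zero (hk : 1 ≤ k) (ha : ∀ s, 1 < a s) (hl : ∀ j, 1 < l j)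
    {δ : Derivation K (CoordRing K k a l) (CoordRing K k a l)} (hδ : IsLND δ) (h0 : δ ≠ 0) :
    δ (coordMono K k a l (natRight k l m)) ≠ 0 := by
  intro h
  have hL : δ (coordMono K k a l (natLeft k a n)) = 0 := by
    rw [coordMono_natLeft, map_add, h, Derivation.map_one_eq_zero, add_zero]
  refine h0 (coordDer_ext fun v => ?_)
  rw [Derivation.zero_apply]
  rcases v with i | s | j
  · exact hδ.apply_eq_zero_of_dvd (coordMono_ne_zero K k a l hk _) hL
      (coordVar_dvd_coordMono K k a l (v := vx i) (by simp))
  · exact hδ.apply_eq_zero_of_dvd (coordMono_ne_zero K k a l hk _) hL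
      (coordVar_dvd_coordMono K k a l (v := vy s) (by have := ha s; simp; omega))
  · exact hδ.apply_eq_zero_of_dvd (coordMono_ne_zero K k a l hk _) h
      (coordVar_dvd_coordMono K k a l (v := vz j) (by have := hl j; simp; omega))

/-- A nonzero homogeneous element of the kernel is a monomial in variables of the kernel. -/
theorem eq_smul_coordMono_of_apply_eq_zero [IsAlgClosed K] (hk : 1 ≤ k) (ha : ∀ s, 1 < a s)
    (hl : ∀ j, 1 < l j) {δ : Derivation K (CoordRing K k a l) (CoordRing K k a l)}
    (hδ : IsLND δ) (h0 : δ ≠ 0) {g : GradingGroup k a l} {b : CoordRing K k a l}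
    (hb : b ∈ homogPart K k a l g) (hb0 : b ≠ 0) (hδb : δ b = 0) :
    ∃ (μ : Var k m n →₀ ℕ) (c : K), c ≠ 0 ∧ monoDeg k a l μ = g ∧
      b = toCoord K k a l (monomial μ c) ∧ ∀ v, μ v ≠ 0 → δ (coordVar K k a l v) = 0 := by
  obtain ⟨μ, f, hμ, rfl⟩ := exists_coordMono_mul_aeval hb hb0
  have hf0 : f ≠ 0 := by
    rintro rfl
    rw [map_zero, mul_zero] at hb0
    exact hb0 rfl
  have hf : f.degree = 0 := by
    by_contra hdeg
    -- The factor z^l - r divides a nonzero kernel element, so it would be killed, and z^l with it.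
    obtain ⟨r, hr⟩ := IsAlgClosed.exists_root f hdeg
    have hdvd := map_dvd (Polynomial.aeval (coordMono K k a l (natRight k l m)))
      (Polynomial.dvd_iff_isRoot.2 hr)
    have := hδ.apply_eq_zero_of_dvd hb0 hδb (hdvd.mul_left (coordMono K k a l μ))
    rw [map_sub, Polynomial.aeval_X, Polynomial.aeval_C, map_sub, Derivation.map_algebraMap,
      sub_zero] at this
    exact apply_natRight_ne_zero hk ha hl hδ h0 this
  obtain ⟨c, rfl⟩ : ∃ c, f = Polynomial.C c := ⟨_, Polynomial.eq_C_of_degree_eq_zero hf⟩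
  refine ⟨μ, c, ?_, hμ, ?_, fun v hv => ?_⟩
  · intro h
    rw [h, map_zero] at hf0
    exact hf0 rfl
  · rw [toCoord_monomial, Polynomial.aeval_C, mul_comm]
  · exact hδ.apply_eq_zero_of_dvd hb0 hδb ((coordVar_dvd_coordMono K k a l hv).mul_right _)

/-- The kernel is generated by the variables that it contains. -/
theorem mem_of_apply_eq_zero [IsAlgClosed K] (hk : 1 ≤ k) (ha : ∀ s, 1 < a s)
    (hl : ∀ j, 1 < l j) {δ : Derivation K (CoordRing K k a l) (CoordRing K k a l)}
    (hδ : IsLND δ) (h0 : δ ≠ 0) {e : GradingGroup k a l} (he : RaisesDegree δ e)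
    {S : Subalgebra K (CoordRing K k a l)}
    (hS : ∀ v, δ (coordVar K k a l v) = 0 → coordVar K k a l v ∈ S)
    {b : CoordRing K k a l} (hδb : δ b = 0) : b ∈ S := by
  obtain ⟨J, c, hc, rfl⟩ := exists_sum_homogPart b
  -- Since δ shifts all degrees by `e`, the images of the components have distinct degrees, so each
  -- component lies in the kernel.
  have hz := eq_zero_of_sum_homogPart_eq_zero (J.map (addRightEmbedding e))
    (fun h => δ (c (h - e))) (fun g _ => by simpa using he (g - e) _ (hc (g - e)))
    (by rw [Finset.sum_map]; simpa using hδb)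
  refine sum_mem fun g hg => ?_
  have hg0 : δ (c g) = 0 := by
    simpa using hz (g + e) (Finset.mem_map_of_mem (addRightEmbedding e) hg)
  by_cases hcg : c g = 0
  · rw [hcg]; exact zero_mem _
  obtain ⟨μ, r, -, -, hμ, hv⟩ := eq_smul_coordMono_of_apply_eq_zero hk ha hl hδ h0 (hc g) hcg hg0
  rw [hμ, toCoord_monomial, coordMono_eq_prod]
  refine mul_mem (Subalgebra.algebraMap_mem _ r) (prod_mem fun v _ => ?_)
  by_cases hμv : μ v = 0
  · rw [hμv, pow_zero]; exact one_mem _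
  · exact pow_mem (hS v (hv v hμv)) _

/-- The last nonzero iterates on u and v are kernel monomials μ and ν of degrees deg u + N e and deg
v + M e. Eliminating e shows that u^M ν^N and v^N μ^M have equal degree. As μ and ν involve neither
u nor v, the exponent difference is M at u and -N at v. -/
theorem exists_relation_of_apply_ne_zero [IsAlgClosed K] (hk : 1 ≤ k) (ha : ∀ s, 1 < a s)
    (hl : ∀ j, 1 < l j) {δ : Derivation K (CoordRing K k a l) (CoordRing K k a l)}
    (hδ : IsLND δ) {e : GradingGroup k a l} (he : RaisesDegree δ e)
    {u v : Var k m n} (huv : u ≠ v) (hu : δ (coordVar K k a l u) ≠ 0)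
    (hv : δ (coordVar K k a l v) ≠ 0) :
    ∃ α β : ℤ, 0 < α * natLeft k a n u + β * natRight k l m u ∧
      α * natLeft k a n v + β * natRight k l m v < 0 := by
  have h0 : δ ≠ 0 := by
    rintro rfl
    exact hu rfl
  have key : ∀ u, δ (coordVar K k a l u) ≠ 0 → ∃ (N : ℕ) (μ : Var k m n →₀ ℕ), N ≠ 0 ∧
      monoDeg k a l μ = degVar k a l u + N • e ∧ ∀ w, μ w ≠ 0 → δ (coordVar K k a l w) = 0 := by
    intro u hu
    obtain ⟨N, hN⟩ := hδ.exists_hasDeg (coordVar_ne_zero K k a l hk u)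
    obtain ⟨μ, c, -, hμ, -, hv⟩ := eq_smul_coordMono_of_apply_eq_zero hk ha hl hδ h0
      (he.iterate N (coordVar_mem_homogPart u)) hN.1 (by
        rw [← Function.iterate_succ_apply' (f := δ)]; exact hN.2)
    refine ⟨N, μ, ?_, hμ, hv⟩
    rintro rfl
    exact hu hN.2
  obtain ⟨N, μ, hN, hμ, hμ'⟩ := key u hu
  obtain ⟨M, ν, hM, hν, hν'⟩ := key v hv
  have heq : monoDeg k a l (Finsupp.single u M + N • ν) =
      monoDeg k a l (Finsupp.single v N + M • μ) := by
    simp only [monoDeg, map_add, map_nsmul, Finsupp.weight_single] at hμ hν ⊢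
    rw [hμ, hν, nsmul_add, nsmul_add, smul_smul, smul_smul, mul_comm M N]
    abel
  rw [monoDeg_eq_mk, monoDeg_eq_mk, mk_eq_mk_iff] at heq
  obtain ⟨α, β, h⟩ := heq
  have zero_of : ∀ {ξ : Var k m n →₀ ℕ} {w : Var k m n},
      (∀ w, ξ w ≠ 0 → δ (coordVar K k a l w) = 0) → δ (coordVar K k a l w) ≠ 0 → ξ w = 0 :=
    fun h hw => by_contra fun hne => hw (h _ hne)
  refine ⟨α, β, ?_, ?_⟩
  · have := h u
    simp only [Finsupp.add_apply, Finsupp.smul_apply, Finsupp.single_eq_same,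
      Finsupp.single_eq_of_ne huv, zero_of hμ' hu, zero_of hν' hu] at this
    simp at this
    omega
  · have := h v
    simp only [Finsupp.add_apply, Finsupp.smul_apply, Finsupp.single_eq_same,
      Finsupp.single_eq_of_ne huv.symm, zero_of hμ' hv, zero_of hν' hv] at this
    simp at this
    omega

/-- Exactly one variable of each of the two monomials lies outside the kernel. -/
theorem exists_apply_ne_zero [IsAlgClosed K] (hk : 1 ≤ k) (ha : ∀ s, 1 < a s)
    (hl : ∀ j, 1 < l j) {δ : Derivation K (CoordRing K k a l) (CoordRing K k a l)}
    (hδ : IsLND δ) (h0 : δ ≠ 0) {e : GradingGroup k a l} (he : RaisesDegree δ e) :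
    ∃ (u : Var k m n) (j : Fin n), natLeft k a n u ≠ 0 ∧ δ (coordVar K k a l u) ≠ 0 ∧
      δ (coordVar K k a l (vz j)) ≠ 0 ∧ ∀ v, v ≠ u → v ≠ vz j → δ (coordVar K k a l v) = 0 := by
  have hR := apply_natRight_ne_zero hk ha hl hδ h0
  have hL : δ (coordMono K k a l (natLeft k a n)) ≠ 0 := by
    rwa [coordMono_natLeft, map_add, Derivation.map_one_eq_zero, add_zero]
  have hz : ∃ j : Fin n, δ (coordVar K k a l (vz j)) ≠ 0 := by
    by_contra! h
    refine hR (apply_coordMono_eq_zero fun v hv => ?_)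
    rcases v with v | v | v
    · exact absurd rfl hv
    · exact absurd rfl hv
    · exact h v
  have hu : ∃ u, natLeft k a n u ≠ 0 ∧ δ (coordVar K k a l u) ≠ 0 := by
    by_contra! h
    exact hL (apply_coordMono_eq_zero h)
  obtain ⟨j, hj⟩ := hz
  obtain ⟨u, huL, hu⟩ := hu
  refine ⟨u, j, huL, hu, hj, fun v hvu hvj => ?_⟩
  by_contra hv
  have huR := (natLeft_eq_zero_or (a := a) (l := l) u).resolve_left huL
  -- A second moved variable in the same monomial would force the single coefficient β (or α) to be
  -- positive at one variable and negative at the other.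
  rcases natLeft_eq_zero_or (a := a) (l := l) v with hvL | hvR
  · obtain ⟨α, β, h1, h2⟩ := exists_relation_of_apply_ne_zero hk ha hl hδ he hvj hv hj
    rw [hvL] at h1
    rw [natLeft_vz] at h2
    simp only [Nat.cast_zero, mul_zero, zero_add] at h1 h2
    have hβ : 0 < β := pos_of_mul_pos_left h1 (Int.natCast_nonneg _)
    exact absurd h2 (not_lt.2 (mul_nonneg hβ.le (Int.natCast_nonneg _)))
  · obtain ⟨α, β, h1, h2⟩ := exists_relation_of_apply_ne_zero hk ha hl hδ he hvu hv hu
    rw [hvR] at h1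
    rw [huR] at h2
    simp only [Nat.cast_zero, mul_zero, add_zero] at h1 h2
    have hα : 0 < α := pos_of_mul_pos_left h1 (Int.natCast_nonneg _)
    exact absurd h2 (not_lt.2 (mul_nonneg hα.le (Int.natCast_nonneg _)))


end HomogeneousLND

/-! ### Classification of homogeneous locally nilpotent derivations -/

section Classification

open MvPolynomial

variable {K : Type*} [Field K] {k m n : ℕ} {a : Fin m → ℕ} {l : Fin n → ℕ}

/-- If `p u^r - q v^s = 1` with `p`, `q` in the kernel of a locally nilpotent derivation `δ` and
`r, s ≥ 2`, then `u` or `v` is in the kernel. -/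
theorem IsLND.apply_eq_zero_or_of_pow_relation {B : Type*} [CommRing B] [IsDomain B] [Algebra K B]
    [CharZero K] {δ : Derivation K B B} (hδ : IsLND δ) {p q u v : B} {r s : ℕ} (hr : 1 < r)
    (hs : 1 < s) (hp : δ p = 0) (hq : δ q = 0) (h : p * u ^ r = q * v ^ s + 1) :
    δ u = 0 ∨ δ v = 0 := by
  by_contra! hne
  obtain ⟨hu, hv⟩ := hne
  have hD := congrArg δ h
  rw [Derivation.leibniz, map_add, Derivation.leibniz, Derivation.leibniz_pow,
    Derivation.leibniz_pow, hp, hq, Derivation.map_one_eq_zero] at hD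
  simp only [smul_eq_mul, nsmul_eq_mul, mul_zero, add_zero] at hD
  have hcr := algebraMap_inv_mul_natCast (K := K) (B := B) (r := r) (by omega)
  have hcs := algebraMap_inv_mul_natCast (K := K) (B := B) (r := s) (by omega)
  have hur : u ^ r = u ^ (r - 1) * u := by rw [← pow_succ, Nat.sub_add_cancel hr.le]
  have hvs : v ^ s = v ^ (s - 1) * v := by rw [← pow_succ, Nat.sub_add_cancel hs.le]
  rw [hur, hvs] at h
  -- Multiply the relation by δ(v) and use its derivative to trade v^{s-1} δ(v) for u^{r-1} δ(u).
  have h1 : u ^ (r - 1) ∣ δ v := by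
    refine ⟨p * u * δ v - algebraMap K B (s : K)⁻¹ * r * v * p * δ u, ?_⟩
    linear_combination (-δ v) * h + (algebraMap K B (s : K)⁻¹ * v) * hD +
      (q * v ^ (s - 1) * v * δ v) * hcs
  have h2 : v ^ (s - 1) ∣ δ u := by
    refine ⟨algebraMap K B (r : K)⁻¹ * s * u * q * δ v - q * v * δ u, ?_⟩
    linear_combination (-δ u) * h + (algebraMap K B (r : K)⁻¹ * u) * hD -
      (p * u ^ (r - 1) * u * δ u) * hcr
  -- Here u and v have degrees N + 1 and M + 1. The divisibilities give (r-1)(N+1) ≤ M and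
  -- (s-1)(M+1) ≤ N, impossible for r, s ≥ 2.
  obtain ⟨N, hN⟩ := hδ.exists_hasDeg hu
  obtain ⟨M, hM⟩ := hδ.exists_hasDeg hv
  have e1 := ((hasDeg_succ_iff.2 hN).pow (r - 1)).le_of_dvd hδ hM h1
  have e2 := ((hasDeg_succ_iff.2 hM).pow (s - 1)).le_of_dvd hδ hN h2
  have e3 : 1 * (N + 1) ≤ (r - 1) * (N + 1) := Nat.mul_le_mul_right _ (by omega)
  have e4 : 1 * (M + 1) ≤ (s - 1) * (M + 1) := Nat.mul_le_mul_right _ (by omega)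
  omega

/-- A homogeneous polynomial that involves neither `x_i` nor `z_j` is a term. -/
theorem IsHomogPoly.eq_monomial {p : MvPolynomial (Var k m n) K} (hp : IsHomogPoly a l p)
    {i : Fin k} {j : Fin n} (hl : l j ≠ 0) (hx : vx i ∉ p.vars) (hz : vz j ∉ p.vars) :
    ∃ μ c, p = monomial μ c := by
  obtain ⟨g, hg⟩ := hp
  by_cases hp0 : p = 0
  · exact ⟨0, 0, by rw [hp0, map_zero]⟩
  obtain ⟨μ, hμ⟩ := ne_zero_iff.1 hp0
  refine ⟨μ, coeff μ p, ?_⟩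
  have hvan : ∀ {ν : Var k m n →₀ ℕ} {v : Var k m n}, coeff ν p ≠ 0 → v ∉ p.vars → ν v = 0 :=
    fun hν hv => by_contra fun hne => hv ((mem_vars_iff_mem_support _).2
      ⟨_, mem_support_iff.2 hν, Finsupp.mem_support_iff.2 hne⟩)
  ext ν
  rw [coeff_monomial]
  split_ifs with hμν
  · rw [hμν]
  by_contra hν
  apply hμν
  have heq : monoDeg k a l μ = monoDeg k a l ν := (hg hμ).trans (hg hν).symm
  rw [monoDeg_eq_mk, monoDeg_eq_mk, mk_eq_mk_iff] at heq
  obtain ⟨α, β, h⟩ := heq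
  -- Both exponents vanish at x_i and at z_j, which forces α = β = 0 and hence equal exponent
  -- vectors.
  have hα := h (vx i)
  have hβ := h (vz j)
  rw [hvan hμ hx, hvan hν hx, natLeft_vx, natRight_vx] at hα
  rw [hvan hμ hz, hvan hν hz, natLeft_vz, natRight_vz] at hβ
  simp only [Nat.cast_zero, Nat.cast_one, mul_zero, mul_one, add_zero, zero_add] at hα hβ
  have hβ0 : β = 0 := (mul_eq_zero.1 hβ.symm).resolve_right (by exact_mod_cast hl)
  ext v
  have := h v
  rw [← hα, hβ0] at this
  simpa using this

/-- The endomorphism rescaling `z_j` by a root of unity. -/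
noncomputable def rescale (j : Fin n) (ζ : K) (hζ : ζ ^ l j = 1) :
    CoordRing K k a l →ₐ[K] CoordRing K k a l :=
  Ideal.Quotient.liftₐ _ (aeval fun v => (if v = vz j then algebraMap K _ ζ else 1) *
    coordVar K k a l v) (fun q hq => by
      obtain ⟨r, rfl⟩ := Ideal.mem_span_singleton'.mp hq
      have hz : ∀ s : Fin n, (if s = j then algebraMap K (CoordRing K k a l) ζ else 1) ^ l s =
          1 := by
        intro s
        split_ifs with h
        · rw [h, ← map_pow, hζ, map_one]
        · exact one_pow _
      have hx : ∀ s : Fin k, (if (vx s : Var k m n) = vz j then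
          algebraMap K (CoordRing K k a l) ζ else 1) = 1 := fun s => if_neg Sum.inl_ne_inr
      have hy : ∀ s : Fin m, (if (vy s : Var k m n) = vz j then
          algebraMap K (CoordRing K k a l) ζ else 1) = 1 := fun s => if_neg (by simp [vy, vz])
      have h0 : toCoord K k a l ((∏ i : Fin k, X (vx i)) * (∏ s : Fin m, X (vy s) ^ a s)
          - ((∏ j : Fin n, X (vz j) ^ l j) + 1)) = 0 :=
        Ideal.Quotient.eq_zero_iff_mem.mpr (Ideal.mem_span_singleton_self _)
      rw [map_mul]
      refine mul_eq_zero_of_right _ ?_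
      change aeval _ ((∏ i : Fin k, X (vx i)) * (∏ s : Fin m, X (vy s) ^ a s)
        - ((∏ j : Fin n, X (vz j) ^ l j) + 1)) = 0
      simp only [map_sub, map_mul, map_prod, map_pow, map_add, map_one, aeval_X, mul_pow,
        (vz_injective k).eq_iff, hx, hy, hz, one_mul] at h0 ⊢
      exact h0)

theorem rescale_coordVar (j : Fin n) (ζ : K) (hζ : ζ ^ l j = 1) (v : Var k m n) :
    rescale (a := a) j ζ hζ (coordVar K k a l v) =
      (if v = vz j then algebraMap K _ ζ else 1) * coordVar K k a l v := by
  have : rescale (a := a) j ζ hζ (coordVar K k a l v) = aeval (fun v => (if v = vz j then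
    algebraMap K _ ζ else 1) * coordVar K k a l v) (X v : MvPolynomial (Var k m n) K) := rfl
  rw [this, aeval_X]

variable [CharZero K] [IsDomain (CoordRing K k a l)]

theorem partialDer_ne_zero (hk : 1 ≤ k) (i : Fin k) (j : Fin n) : partialDer K k a l i j ≠ 0 := by
  intro h
  have := partialDer_vz K k a l i j
  rw [h, Derivation.zero_apply] at this
  exact coordMono_ne_zero K k a l hk _ this.symm

/-- Every nonzero homogeneous locally nilpotent derivation is `c x^μ ∂_{ij}`, where the monomial
`x^μ` does not involve `x_i` and `z_j`. -/
theorem IsHomogDer.eq_monomial_smul_partialDer [IsAlgClosed K] (hk : 1 ≤ k) (ha : ∀ s, 1 < a s)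
    (hl : ∀ j, 1 < l j) {δ : Derivation K (CoordRing K k a l) (CoordRing K k a l)}
    (hδ : IsLND δ) (hhom : IsHomogDer δ) (h0 : δ ≠ 0) :
    ∃ (i : Fin k) (j : Fin n) (μ : Var k m n →₀ ℕ) (c : K), c ≠ 0 ∧ μ (vx i) = 0 ∧
      μ (vz j) = 0 ∧ δ = toCoord K k a l (monomial μ c) • partialDer K k a l i j := by
  obtain ⟨e, he⟩ := hhom.exists_raisesDegree
  obtain ⟨u, j, huL, hu, hj, hrest⟩ := exists_apply_ne_zero hk ha hl hδ h0 he
  have huR := (natLeft_eq_zero_or (a := a) (l := l) u).resolve_left huL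
  rcases u with i | s | j'
  · have heq := eq_smul_partialDer (i := i) (by have := hl j; omega) hrest
    set h := coordVar K k a l (vx i) * δ (coordVar K k a l (vz j)) - algebraMap K _ (l j : K)⁻¹ *
      (coordVar K k a l (vz j) * δ (coordVar K k a l (vx i))) with hh
    have hh0 : h ≠ 0 := by
      intro h1
      rw [h1] at heq
      exact h0 (heq.trans (zero_smul_derivation _))
    -- A multiple of the LND ∂_{ij} that is again an LND has its factor in the kernel; being
    -- homogeneous, h is then a monomial in kernel variables.
    have hker : δ h = 0 := by
      have : partialDer K k a l i j h = 0 :=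
        (isLND_partialDer K k a l i j).apply_eq_zero_of_smul (heq ▸ hδ)
      rw [heq, Derivation.smul_apply, this, smul_zero]
    have hmem : h ∈ homogPart K k a l (degVar k a l (vx i) + (degVar k a l (vz j) + e)) := by
      refine sub_mem ?_ ?_
      · exact mul_mem_homogPart (coordVar_mem_homogPart _) (he _ _ (coordVar_mem_homogPart _))
      · rw [← Algebra.smul_def, add_left_comm]
        exact Submodule.smul_mem _ _
          (mul_mem_homogPart (coordVar_mem_homogPart _) (he _ _ (coordVar_mem_homogPart _)))
    obtain ⟨μ, c, hc, -, hμ, hvar⟩ :=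
      eq_smul_coordMono_of_apply_eq_zero hk ha hl hδ h0 hmem hh0 hker
    refine ⟨i, j, μ, c, hc, ?_, ?_, ?_⟩
    · exact by_contra fun hne => hu (hvar _ hne)
    · exact by_contra fun hne => hj (hvar _ hne)
    · rw [← hμ]
      exact heq
  -- A moved y_s occurs with exponent at least 2, as does z_j, and their cofactors are killed; the
  -- degree count rules this out.
  · exfalso
    have hR := coordMono_natLeft K k a l
    rw [coordMono_eq_mul_erase K k a l (natLeft k a n) (vy s),
      coordMono_eq_mul_erase K k a l (natRight k l m) (vz j), natLeft_vy, natRight_vz] at hR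
    have h1 : δ (coordMono K k a l ((natLeft k a n).erase (vy s))) = 0 := by
      refine apply_coordMono_eq_zero fun v hv => ?_
      have hs : v ≠ vy s := by
        rintro rfl
        exact hv Finsupp.erase_same
      refine hrest v hs ?_
      rintro rfl
      rw [Finsupp.erase_ne hs] at hv
      exact hv rfl
    have h2 : δ (coordMono K k a l ((natRight k l m).erase (vz j))) = 0 := by
      refine apply_coordMono_eq_zero fun v hv => ?_
      have hz : v ≠ vz j := by
        rintro rfl
        exact hv Finsupp.erase_same
      refine hrest v ?_ hz
      rintro rfl
      rw [Finsupp.erase_ne hz] at hv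
      exact hv rfl
    exact (hδ.apply_eq_zero_or_of_pow_relation (ha s) (hl j) h1 h2 hR).elim hu hj
  · exact absurd rfl huL

end Classification

/-! ### Commuting derivations and maximality -/

section Maximality

open MvPolynomial

variable {K : Type*} [Field K] {k m n : ℕ} {a : Fin m → ℕ} {l : Fin n → ℕ}

theorem partialDer_toCoord_eq_zero (i : Fin k) {j : Fin n} {p : MvPolynomial (Var k m n) K}
    (hx : vx i ∉ p.vars) (hz : vz j ∉ p.vars) :
    partialDer K k a l i j (toCoord K k a l p) = 0 := by
  rw [partialDer_toCoord, derivation_eq_zero_of_forall_mem_vars, map_zero]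
  intro v hv
  have hvx : v ≠ vx i := by
    rintro rfl
    exact hx hv
  have hvz : v ≠ vz j := by
    rintro rfl
    exact hz hv
  rw [polyDer, mkDerivation_X]
  rcases v with r | r | r
  · rw [Sum.elim_inl, if_neg]
    rintro rfl
    exact hvx rfl
  · rfl
  · rw [Sum.elim_inr, Sum.elim_inr, if_neg]
    rintro rfl
    exact hvz rfl

variable [CharZero K] [IsDomain (CoordRing K k a l)]

/-- A locally nilpotent derivation that commutes with `∂_{ij}` kills `y^a ∏_{s ≠ i} x_s`. -/
theorem apply_cofactorX_eq_zero_of_commute [IsAlgClosed K] (hk : 1 ≤ k) (ha : ∀ s, 1 < a s)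
    (hl : ∀ j, 1 < l j) {i : Fin k} {j : Fin n}
    {D : Derivation K (CoordRing K k a l) (CoordRing K k a l)} (hD : IsLND D)
    (hcomm : ∀ b, partialDer K k a l i j (D b) = D (partialDer K k a l i j b)) :
    D (cofactorX K k a l i) = 0 := by
  have hl0 : l j ≠ 0 := by have := hl j; omega
  have : NeZero (l j : K) := ⟨by exact_mod_cast hl0⟩
  obtain ⟨ζ, hζ⟩ := HasEnoughRootsOfUnity.exists_primitiveRoot K (l j)
  -- The kernel of ∂_{ij} is generated by the variables in it, and z_j is not among them, so
  -- rescaling z_j fixes the kernel pointwise.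
  have hfix : ∀ {b : CoordRing K k a l}, partialDer K k a l i j b = 0 →
      rescale j ζ hζ.pow_eq_one b = b := by
    intro b hb
    refine mem_of_apply_eq_zero hk ha hl (isLND_partialDer K k a l i j) (partialDer_ne_zero hk i j)
      (raisesDegree_partialDer i hl0)
      (S := AlgHom.equalizer (rescale j ζ hζ.pow_eq_one) (AlgHom.id K _)) (fun v hv => ?_) hb
    rw [AlgHom.mem_equalizer, rescale_coordVar, if_neg, one_mul, AlgHom.id_apply]
    rintro rfl
    rw [partialDer_vz] at hv
    exact coordMono_ne_zero K k a l hk _ hv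
  set w := cofactorX K k a l i with hw
  set z := coordVar K k a l (vz j) with hz
  have hwker : partialDer K k a l i j w = 0 :=
    apply_cofactorX_eq_zero fun v hx hz => partialDer_of_ne K k a l i j hx hz
  have hDw : partialDer K k a l i j (D w) = 0 := by rw [hcomm, hwker, map_zero]
  -- Both terms are sent to w D(w). Comparing this kernel element with its rescaled image gives w
  -- (D(z) - σ(D(z))) = (1 - ζ) z D(w), so w divides z D(w). Because w is coprime to z, it divides
  -- D(w).
  have he : partialDer K k a l i j (w * D z - z * D w) = 0 := by
    rw [map_sub, Derivation.leibniz, Derivation.leibniz, hcomm, hz, partialDer_vz, ← hw, hwker, hDw]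
    simp [mul_comm]
  have hσ := congrArg (rescale j ζ hζ.pow_eq_one) (sub_add_cancel (w * D z) (z * D w))
  rw [map_add, hfix he, map_mul, map_mul, hfix hwker, hfix hDw, hz, rescale_coordVar, if_pos rfl,
    ← hz] at hσ
  have h1 : w ∣ algebraMap K _ (1 - ζ) * (z * D w) := by
    refine ⟨D z - rescale j ζ hζ.pow_eq_one (D z), ?_⟩
    rw [map_sub, map_one]
    linear_combination -hσ
  have hζ1 : (1 : K) - ζ ≠ 0 := sub_ne_zero.2 (hζ.ne_one (hl j)).symm
  have h2 : w ∣ z * D w := by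
    have := h1.mul_left (algebraMap K _ (1 - ζ)⁻¹)
    rwa [← mul_assoc, ← map_mul, inv_mul_cancel₀ hζ1, map_one, one_mul] at this
  refine hD.apply_eq_zero_of_dvd_apply ?_
  have hR := cofactor_relation K k a l i j
  have hpow : z ^ l j = z ^ (l j - 1) * z := by
    rw [← pow_succ, Nat.sub_add_cancel (Nat.one_le_iff_ne_zero.2 hl0)]
  rw [← hw, ← hz, hpow] at hR
  have h3 := ((dvd_refl w).mul_right (coordVar K k a l (vx i) * D w)).sub
    (h2.mul_left (cofactorZ K k a l j * z ^ (l j - 1)))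
  convert h3 using 1
  linear_combination (-D w) * hR

/-- The derivations `c x^μ ∂_{ij}` are maximal if `x^μ` involves every `z_s` with `s ≠ j`. -/
theorem isMaximalDer_monomial_smul_partialDer [IsAlgClosed K] (hk : 1 ≤ k)
    (ha : ∀ s, 1 < a s) (hl : ∀ j, 1 < l j) {i : Fin k} {j : Fin n} {μ : Var k m n →₀ ℕ} {c : K}
    (hc : c ≠ 0) (hz : ∀ s, s ≠ j → μ (vz s) ≠ 0) :
    IsMaximalDer (toCoord K k a l (monomial μ c) • partialDer K k a l i j) := by
  intro D hD hD0 hcomm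
  have hl0 : l j ≠ 0 := by have := hl j; omega
  set h := toCoord K k a l (monomial μ c) with hh
  have hmono : h = algebraMap K _ c * coordMono K k a l μ := toCoord_monomial K k a l μ c
  have hh0 : h ≠ 0 := by
    rw [hmono]
    exact mul_ne_zero ((map_ne_zero_iff _ (algebraMap K (CoordRing K k a l)).injective).2 hc)
      (coordMono_ne_zero K k a l hk _)
  have hcomm' : ∀ b, h * partialDer K k a l i j (D b) =
      D h * partialDer K k a l i j b + h * D (partialDer K k a l i j b) := by
    intro b
    have := DFunLike.congr_fun hcomm b
    rw [Derivation.commutator_apply, Derivation.zero_apply, sub_eq_zero, Derivation.smul_apply,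
      Derivation.smul_apply, smul_eq_mul, smul_eq_mul, Derivation.leibniz, smul_eq_mul,
      smul_eq_mul] at this
    rw [this]
    ring
  -- Commutation makes h divide D(h) ∂_{ij}(b) for every b, hence D(h) itself, and then D(h) = 0 by
  -- degree.
  have hDh : D h = 0 := by
    refine hD.apply_eq_zero_of_dvd_apply
      (dvd_of_forall_dvd_mul_partialDer K k a l hl0 (i := i) (j := j) fun b => ?_)
    refine ⟨partialDer K k a l i j (D b) - D (partialDer K k a l i j b), ?_⟩
    linear_combination -(hcomm' b)
  have hw := apply_cofactorX_eq_zero_of_commute hk ha hl (i := i) (j := j) hD fun b => by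
    have := hcomm' b
    rw [hDh, zero_mul, zero_add] at this
    exact mul_left_cancel₀ hh0 this
  -- The remaining x and y variables divide `cofactorX`, and the z_s with s ≠ j divide h; both
  -- elements are nonzero and killed by D.
  have hkill : ∀ v, v ≠ vx i → v ≠ vz j → D (coordVar K k a l v) = 0 := by
    intro v hvx hvz
    have hL : natLeft k a n v ≠ 0 → D (coordVar K k a l v) = 0 := fun hv =>
      hD.apply_eq_zero_of_dvd (coordMono_ne_zero K k a l hk _) hw
        (coordVar_dvd_coordMono K k a l (by rwa [Finsupp.erase_ne hvx]))
    rcases v with s | s | s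
    · exact hL one_ne_zero
    · exact hL (by have := ha s; change a s ≠ 0; omega)
    · refine hD.apply_eq_zero_of_dvd hh0 hDh ?_
      rw [hmono]
      refine (coordVar_dvd_coordMono K k a l (hz s ?_)).mul_left _
      rintro rfl
      exact hvz rfl
  have heq := eq_smul_partialDer hl0 hkill
  set g := coordVar K k a l (vx i) * D (coordVar K k a l (vz j)) - algebraMap K _ (l j : K)⁻¹ *
      (coordVar K k a l (vz j) * D (coordVar K k a l (vx i)))
  have hg0 : g ≠ 0 := by
    intro h0
    rw [h0] at heq
    exact hD0 (heq.trans (zero_smul_derivation _))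
  intro b
  rw [heq, Derivation.smul_apply, Derivation.smul_apply, smul_eq_mul, smul_eq_mul, mul_eq_zero,
    mul_eq_zero, or_iff_right hg0, or_iff_right hh0]

/-- If the factor `h` does not involve `z_s` for some `s ≠ j`, then `h ∂_{ij}` is not maximal. -/
theorem mem_vars_of_isMaximalDer (hk : 1 ≤ k) (hn : 1 < n) {i : Fin k} {j : Fin n}
    {p : MvPolynomial (Var k m n) K} (hx : vx i ∉ p.vars) (hp : toCoord K k a l p ≠ 0)
    (hmax : IsMaximalDer (toCoord K k a l p • partialDer K k a l i j)) {s : Fin n} (hs : s ≠ j) :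
    vz s ∈ p.vars := by
  by_contra hz
  -- If h avoids x_i and z_s, then ∂_{is} kills h and so commutes with h ∂_{ij}. It also kills z_j,
  -- which h ∂_{ij} does not.
  have h := hmax (partialDer K k a l i s) (isLND_partialDer K k a l i s)
    (partialDer_ne_zero hk i s) ?_ (coordVar K k a l (vz j))
  · rw [Derivation.smul_apply, partialDer_vz, partialDer_of_ne K k a l i s (v := vz j)
      Sum.inr_ne_inl ((vz_injective k).ne hs.symm)] at h
    exact mul_ne_zero hp (coordMono_ne_zero K k a l hk _) (h.1 rfl)
  · ext b
    have hcomm := DFunLike.congr_fun (partialDer_commute K k a l hk hn i j s) b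
    rw [Derivation.commutator_apply, Derivation.zero_apply, sub_eq_zero] at hcomm
    rw [Derivation.commutator_apply, Derivation.smul_apply, Derivation.smul_apply,
      smul_eq_mul, smul_eq_mul, Derivation.leibniz, partialDer_toCoord_eq_zero i hx hz, hcomm,
      smul_zero, add_zero, smul_eq_mul, sub_self,
      Derivation.zero_apply]

/-- The maximal homogeneous locally nilpotent derivations. -/
theorem isMaximalDer_iff [IsAlgClosed K] (hk : 1 ≤ k) (hn : 1 < n) (ha : ∀ s, 1 < a s)
    (hl : ∀ j, 1 < l j) (δ : Derivation K (CoordRing K k a l) (CoordRing K k a l)) :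
    (IsLND δ ∧ IsHomogDer δ ∧ IsMaximalDer δ) ↔
      ∃ (i : Fin k) (j : Fin n) (h : MvPolynomial (Var k m n) K),
        IsHomogPoly a l h ∧ vx i ∉ h.vars ∧ vz j ∉ h.vars ∧
          (∀ s : Fin n, s ≠ j → vz s ∈ h.vars) ∧
          δ = toCoord K k a l h • partialDer K k a l i j := by
  have hl0 : ∀ j, l j ≠ 0 := fun j => by have := hl j; omega
  constructor
  · rintro ⟨hδ, hhom, hmax⟩
    -- The zero derivation commutes with every ∂_{ij} but has a larger kernel, so it is not maximal.
    have h0 : δ ≠ 0 := by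
      rintro rfl
      have := hmax (partialDer K k a l ⟨0, hk⟩ ⟨0, by omega⟩) (isLND_partialDer K k a l _ _)
        (partialDer_ne_zero hk _ _) (Derivation.ext fun b => by
          simp [Derivation.commutator_apply])
      exact partialDer_ne_zero hk _ _ (Derivation.ext fun b => (this b).2 rfl)
    obtain ⟨i, j, μ, c, hc, hx, hz, rfl⟩ := hhom.eq_monomial_smul_partialDer hk ha hl hδ h0
    have hvars : ∀ v, v ∈ (monomial μ c).vars ↔ μ v ≠ 0 := fun v => by
      rw [vars_monomial hc, Finsupp.mem_support_iff]
    have hx' : vx i ∉ (monomial μ c).vars := by rw [hvars, hx]; exact fun h => h rfl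
    refine ⟨i, j, monomial μ c, ⟨_, isWeightedHomogeneous_monomial _ _ _ rfl⟩, hx',
      by rw [hvars, hz]; exact fun h => h rfl, fun s hs =>
        mem_vars_of_isMaximalDer hk hn hx' ?_ hmax hs, rfl⟩
    rintro h
    rw [h] at h0
    exact h0 (zero_smul_derivation _)
  · rintro ⟨i, j, h, hhom, hx, hz, hs, rfl⟩
    obtain ⟨e, he⟩ : ∃ e, RaisesDegree (partialDer K k a l i j) e :=
      ⟨_, raisesDegree_partialDer i (hl0 j)⟩
    refine ⟨(isLND_partialDer K k a l i j).smul (partialDer_toCoord_eq_zero i hx hz), ?_, ?_⟩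
    · obtain ⟨d, hd⟩ := hhom
      intro b hb
      obtain ⟨g, hg⟩ := isHomogElem_iff.1 hb
      exact isHomogElem_iff.2 ⟨_, mul_mem_homogPart ⟨h, hd, rfl⟩ (he g b hg)⟩
    · obtain ⟨μ, c, rfl⟩ := hhom.eq_monomial (hl0 j) hx hz
      -- Since n > 1, some z_s with s ≠ j must occur in h, which rules out h = 0.
      have hc : c ≠ 0 := by
        rintro rfl
        obtain ⟨s, hsj⟩ : ∃ s : Fin n, s ≠ j :=
          haveI : Nontrivial (Fin n) := Fin.nontrivial_iff_two_le.2 hn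
          exists_ne j
        have := hs s hsj
        rw [map_zero, vars_0] at this
        exact absurd this (Finset.notMem_empty _)
      simp only [vars_monomial hc, Finsupp.mem_support_iff] at hs
      exact isMaximalDer_monomial_smul_partialDer hk ha hl hc hs

/-- An irreducible homogeneous locally nilpotent derivation is not maximal. -/
theorem not_isMaximalDer_of_isIrreducibleDer [IsAlgClosed K] (hk : 1 ≤ k) (hn : 1 < n)
    (ha : ∀ s, 1 < a s) (hl : ∀ j, 1 < l j)
    {δ : Derivation K (CoordRing K k a l) (CoordRing K k a l)} (hδ : IsLND δ) (hhom : IsHomogDer δ)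
    (hirr : IsIrreducibleDer δ) : ¬ IsMaximalDer δ := by
  intro hmax
  obtain ⟨i, j, h, hh, hx, hz, hs, rfl⟩ := (isMaximalDer_iff hk hn ha hl δ).1 ⟨hδ, hhom, hmax⟩
  obtain ⟨s, hsj⟩ : ∃ s : Fin n, s ≠ j :=
    haveI : Nontrivial (Fin n) := Fin.nontrivial_iff_two_le.2 hn
    exists_ne j
  obtain ⟨μ, c, rfl⟩ := hh.eq_monomial (by have := hl j; omega) hx hz
  -- Maximality forces z_s to divide the factor h, so the image lies in the proper ideal (z_s).
  refine hirr (Ideal.span {coordVar K k a l (vz s)}) ⟨⟨_, rfl⟩⟩ ?_ ?_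
  · rw [Ne, Ideal.span_singleton_eq_top]
    exact not_isUnit_coordVar_vz K k a l hl s
  · rintro _ ⟨b, rfl⟩
    have hμ : μ (vz s) ≠ 0 := by
      obtain ⟨ν, hν, hsν⟩ := (mem_vars_iff_mem_support _).1 (hs s hsj)
      rw [Finset.mem_singleton.1 (support_monomial_subset hν)] at hsν
      exact Finsupp.mem_support_iff.1 hsν
    rw [Derivation.smul_apply, toCoord_monomial, smul_eq_mul, SetLike.mem_coe,
      Ideal.mem_span_singleton]
    exact ((coordVar_dvd_coordMono K k a l hμ).mul_left _).mul_right _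

end Maximality

end TrinomialLND

open TrinomialLND in
theorem mainTheorem8 {K : Type*} [Field K] [IsAlgClosed K] [CharZero K]
    {k m n : ℕ} (hk : 1 ≤ k) (hn : 1 < n)
    (a : Fin m → ℕ) (ha : ∀ s, 1 < a s) (l : Fin n → ℕ) (hl : ∀ j, 1 < l j) :
    -- each `∂_{ij}` is an irreducible homogeneous LND
    (∀ (i : Fin k) (j : Fin n),
      IsLND (partialDer K k a l i j) ∧ IsHomogDer (partialDer K k a l i j) ∧
        IsIrreducibleDer (partialDer K k a l i j)) ∧
    -- no irreducible homogeneous LND is maximal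
    (∀ δ : Derivation K (CoordRing K k a l) (CoordRing K k a l),
      IsLND δ → IsHomogDer δ → IsIrreducibleDer δ → ¬ IsMaximalDer δ) ∧
    -- the maximal homogeneous LNDs are exactly the replicas `h ∂_{ij}` described below
    (∀ δ : Derivation K (CoordRing K k a l) (CoordRing K k a l),
      (IsLND δ ∧ IsHomogDer δ ∧ IsMaximalDer δ) ↔
        ∃ (i : Fin k) (j : Fin n) (h : MvPolynomial (Var k m n) K),
          IsHomogPoly a l h ∧ vx i ∉ h.vars ∧ vz j ∉ h.vars ∧
            (∀ s : Fin n, s ≠ j → vz s ∈ h.vars) ∧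
            δ = toCoord K k a l h • partialDer K k a l i j) := by
  have : IsDomain (CoordRing K k a l) := isDomain_coordRing K k a l hk hn hl
  have hl0 : ∀ j, l j ≠ 0 := fun j => by have := hl j; omega
  exact ⟨fun i j => ⟨isLND_partialDer K k a l i j,
    (raisesDegree_partialDer i (hl0 j)).isHomogDer, isIrreducibleDer_partialDer K k a l i (hl0 j)⟩,
    fun δ hδ hhom hirr => not_isMaximalDer_of_isIrreducibleDer hk hn ha hl hδ hhom hirr,
    isMaximalDer_iff hk hn ha hl⟩
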